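/- A linkage $\mathcal L=(G,\ell)$ consists of a finite graph $G=(V,E)$ (parallel edges and loops allowed), each edge having a fixed orientation, and a length function $\ell:E\to\mathbb R_{\ge 0}$; the edges are called bars. A configuration of $\mathcal L$ is a map $C:V\to\mathbb R^2$ with $|C(u)-C(v)|=\ell(e)$ for every bar $e=(u,v)$; it assigns to $e$ the oriented segment $C(e)$ from $C(u)$ to $C(v)$. Write $\mathrm{Conf}(\mathcal L)$ for the set of configurations. A configuration is nontouching if any common point of the segments of two different bars is an endpoint of both segments, and if, for any two vertices $u,v$ that are endpoints of bars, $C(u)=C(v)$ if and only if $u$ and $v$ are connected by a (possibly trivial) path of bars of length zero. For $\epsilon\ge 0$, a linkage $(G',\ell')$ is $\epsilon$-related to $(G,\ell)$ if $G'=G$ and $|\ell(e)-\ell'(e)|\le\epsilon$ for all $e\in E$. Let $\mathrm{Conf}_\epsilon(\mathcal L)$ (respectively $\mathrm{NConf}_\epsilon(\mathcal L)$) be the set of all configurations (respectively all nontouching configurations) of linkages that are $\epsilon$-related to $\mathcal L$. For oriented segments $e_1,e_2$ in the plane use positively oriented orthonormal coordinates whose origin is the first endpoint of $e_1$ and whose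 $x$-axis is directed along $e_1$, so that $e_1$ is the interval from $0$ to its length $l$ on the $x$-axis, and put $$d_+(e_1,e_2)=\mathrm{len}\{x\in[0,l] : \exists\, y\ge 0,\ (x,y)\in e_2\},\qquad d_-(e_1,e_2)=\mathrm{len}\{x\in[0,l] : \exists\, y\le 0,\ (x,y)\in e_2\}$$ (both are $0$ if $l=0$), and $\mathrm{Ord}(e_1,e_2)=d_+(e_1,e_2)-d_-(e_1,e_2)$. The annotation of $C:V\to\mathbb R^2$ is the matrix $A\in\mathbb R^{E\times E}$ with $A_{e,f}=\mathrm{Ord}(C(e),C(f))$, and $\mathrm{Annot}(C)=(C,A)$. The set of annotated nontouching $\epsilon$-related configurations of $\mathcal L$ is $\mathrm{Annot}(\mathrm{NConf}_\epsilon(\mathcal L))$. The space of noncrossing configurations of $\mathcal L$ is $$\mathrm{NC}(\mathcal L)=\bigl(\mathrm{Conf}(\mathcal L)\times\mathbb R^{E\times E}\bigr)\cap\overline{\mathrm{Annot}(\mathrm{NConf}_1(\mathcal L))},$$ and $\mathrm{NC}_\epsilon(\mathcal L)$ denotes the union of $\mathrm{NC}(\mathcal L')$ over all linkages $\mathcal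 L'$ that are $\epsilon$-related to $\mathcal L$, so that $\mathrm{NC}_0(\mathcal L)=\mathrm{NC}(\mathcal L)$. A subset of $\mathbb R^n$ is semi-algebraic if it is a finite Boolean combination of sets of the form $\{x: f(x)=0\}$ and $\{x: f(x)<0\}$ with $f$ a real polynomial in $n$ variables. **Theorem.** For every linkage $\mathcal L$ and every $\epsilon\ge 0$, the sets $\mathrm{Conf}_\epsilon(\mathcal L)$ and $\mathrm{NConf}_\epsilon(\mathcal L)$ are semi-algebraic subsets of $(\mathbb R^2)^V$, and the sets $\mathrm{Annot}(\mathrm{NConf}_\epsilon(\mathcal L))$, $\mathrm{NC}(\mathcal L)$ and $\mathrm{NC}_\epsilon(\mathcal L)$ are semi-algebraic subsets of $(\mathbb R^2)^V\times\mathbb R^{E\times E}$. -/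

import Mathlib

open MeasureTheory
open scoped NNReal

/-! ### Semi-algebraic sets -/

/-- Semi-algebraic subsets of `ℝ^ι` (for a finite index type `ι`): the finite Boolean combinations
of the sets `{x | f x = 0}` and `{x | f x < 0}`, where `f` is a real polynomial in the coordinates. -/
inductive IsSemialgebraic {ι : Type*} : Set (ι → ℝ) → Prop
  | eq_zero (f : MvPolynomial ι ℝ) : IsSemialgebraic {x | MvPolynomial.eval x f = 0}
  | lt_zero (f : MvPolynomial ι ℝ) : IsSemialgebraic {x | MvPolynomial.eval x f < 0}
  | compl {S : Set (ι → ℝ)} : IsSemialgebraic S → IsSemialgebraic Sᶜ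
  | union {S T : Set (ι → ℝ)} : IsSemialgebraic S → IsSemialgebraic T → IsSemialgebraic (S ∪ T)
  | inter {S T : Set (ι → ℝ)} : IsSemialgebraic S → IsSemialgebraic T → IsSemialgebraic (S ∩ T)

/-! ### The order function -/

/-- The Euclidean plane. -/
abbrev Plane : Type := EuclideanSpace ℝ (Fin 2)

/-- Counterclockwise rotation by a right angle. -/
noncomputable def rotateLeft (v : Plane) : Plane := !₂[-(v 1), v 0]

/-- An oriented edge in the plane, as its ordered pair of endpoints. -/
abbrev PlaneEdge : Type := Plane × Plane

namespace PlaneEdge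

/-- The closed segment covered by an edge. -/
def carrier (e : PlaneEdge) : Set Plane := segment ℝ e.1 e.2

/-- The length of an edge. -/
noncomputable def length (e : PlaneEdge) : ℝ := dist e.1 e.2

/-- The unit vector along an edge (zero for an edge of length zero). -/
noncomputable def direction (e : PlaneEdge) : Plane := (e.length)⁻¹ • (e.2 - e.1)

/-- The point with coordinates `(x, y)` in the positively oriented orthonormal frame whose origin is
the first endpoint of `e` and whose `x`-axis is directed along `e`. -/
noncomputable def framePoint (e : PlaneEdge) (x y : ℝ) : Plane :=
  e.1 + x • e.direction + y • rotateLeft e.direction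

/-- Length of the projection to `e₁` of the part of `e₂` above `e₁`. In the frame of `e₁`, the edge
`e₁` is the interval `[0, length e₁]` of the `x`-axis. If `e₁` has length zero, this is zero. -/
noncomputable def dPlus (e₁ e₂ : PlaneEdge) : ℝ :=
  (volume : Measure ℝ).real
    {x | x ∈ Set.Icc 0 e₁.length ∧ ∃ y : ℝ, 0 ≤ y ∧ e₁.framePoint x y ∈ e₂.carrier}

/-- Length of the projection to `e₁` of the part of `e₂` below `e₁`. -/
noncomputable def dMinus (e₁ e₂ : PlaneEdge) : ℝ :=
  (volume : Measure ℝ).real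
    {x | x ∈ Set.Icc 0 e₁.length ∧ ∃ y : ℝ, y ≤ 0 ∧ e₁.framePoint x y ∈ e₂.carrier}

/-- The order function. -/
noncomputable def ord (e₁ e₂ : PlaneEdge) : ℝ := dPlus e₁ e₂ - dMinus e₁ e₂

end PlaneEdge

/-! ### Linkages -/

/-- A graph with vertices `V` and edges `E`, each edge carrying its canonical orientation, which only
serves to define annotations. Parallel edges and loops are allowed; simple graphs are the case in
which there are none. -/
structure OrientedGraph (V E : Type*) where
  /-- The first endpoint of an edge. -/
  src : E → V
  /-- The second endpoint of an edge. -/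
  tgt : E → V

/-- A linkage: a graph together with nonnegative lengths of its edges, the bars. -/
structure Linkage (V E : Type*) where
  /-- The underlying graph. -/
  graph : OrientedGraph V E
  /-- The bar lengths. -/
  len : E → ℝ≥0

/-- A placement of the vertices in the plane together with a real matrix indexed by pairs of bars. -/
abbrev AnnotatedPlacement (V E : Type*) : Type _ := (V → Plane) × Matrix E E ℝ

/-- The planar oriented edge that a placement of the vertices assigns to an edge of a graph. -/
def OrientedGraph.edgeImage {V E : Type*} (G : OrientedGraph V E) (C : V → Plane) (e : E) :
    PlaneEdge :=
  (C (G.src e), C (G.tgt e))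

/-- The annotation map, `C ↦ (C, A)` with `A i j = Ord (C e_i, C e_j)`. -/
noncomputable def OrientedGraph.annot {V E : Type*} (G : OrientedGraph V E) (C : V → Plane) :
    AnnotatedPlacement V E :=
  (C, Matrix.of fun i j => PlaneEdge.ord (G.edgeImage C i) (G.edgeImage C j))

namespace Linkage

variable {V E : Type*}

/-- The configuration space. -/
def Conf (L : Linkage V E) : Set (V → Plane) :=
  {C | ∀ e : E, dist (C (L.graph.src e)) (C (L.graph.tgt e)) = L.len e}

/-- The vertex `v` is an endpoint of the bar `e`. -/
def IsEndpoint (L : Linkage V E) (v : V) (e : E) : Prop :=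
  v = L.graph.src e ∨ v = L.graph.tgt e

/-- Two vertices are joined by a zero-length bar. -/
def ZeroAdj (L : Linkage V E) (u v : V) : Prop :=
  ∃ e : E, L.len e = 0 ∧
    ((L.graph.src e = u ∧ L.graph.tgt e = v) ∨ (L.graph.src e = v ∧ L.graph.tgt e = u))

/-- Two vertices are connected by a (possibly trivial) path of zero-length bars. -/
def ZeroConnected (L : Linkage V E) : V → V → Prop :=
  Relation.ReflTransGen L.ZeroAdj

/-- The nontouching configurations: any common point of two different bars is an endpoint of both,
and two endpoints of bars coincide if and only if they are connected by a path of zero-length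
bars. -/
def NConf (L : Linkage V E) : Set (V → Plane) :=
  {C | C ∈ L.Conf ∧
    (∀ e f : E, e ≠ f → ∀ p : Plane,
      p ∈ (L.graph.edgeImage C e).carrier → p ∈ (L.graph.edgeImage C f).carrier →
        (∃ u, L.IsEndpoint u e ∧ C u = p) ∧ (∃ v, L.IsEndpoint v f ∧ C v = p)) ∧
    (∀ u v : V, (∃ e, L.IsEndpoint u e) → (∃ f, L.IsEndpoint v f) →
      (C u = C v ↔ L.ZeroConnected u v))}

/-- `ε`-related linkages: same graph, and bar lengths that differ by at most `ε`. -/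
def Related (ε : ℝ) (L₁ L₂ : Linkage V E) : Prop :=
  L₁.graph = L₂.graph ∧ ∀ e : E, |(L₁.len e : ℝ) - (L₂.len e : ℝ)| ≤ ε

/-- The `ε`-related configurations of `L`. -/
def ConfRel (ε : ℝ) (L : Linkage V E) : Set (V → Plane) :=
  {C | ∃ L' : Linkage V E, Related ε L L' ∧ C ∈ L'.Conf}

/-- The nontouching `ε`-related configurations of `L`. -/
def NConfRel (ε : ℝ) (L : Linkage V E) : Set (V → Plane) :=
  {C | ∃ L' : Linkage V E, Related ε L L' ∧ C ∈ L'.NConf}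

/-- The annotated nontouching `ε`-related configurations of `L`. -/
noncomputable def AnnNConfRel (ε : ℝ) (L : Linkage V E) : Set (AnnotatedPlacement V E) :=
  L.graph.annot '' L.NConfRel ε

/-- The noncrossing configurations of `L`: the pairs `(C, A)` with `C` a configuration of `L` that
are limits of annotated nontouching configurations of linkages `1`-related to `L`. -/
noncomputable def NoncrossingConf (L : Linkage V E) : Set (AnnotatedPlacement V E) :=
  {p | p.1 ∈ L.Conf ∧ p ∈ closure (L.AnnNConfRel 1)}

/-- The noncrossing `ε`-related configurations of `L`: the noncrossing configurations of the
linkages `ε`-related to `L`. -/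
noncomputable def NoncrossingConfRel (ε : ℝ) (L : Linkage V E) : Set (AnnotatedPlacement V E) :=
  {p | ∃ L' : Linkage V E, Related ε L L' ∧ p ∈ L'.NoncrossingConf}

end Linkage

/-! ### Coordinates -/

/-- The identification of the placements of `V` with `ℝ^(V × 2)`. -/
def placementCoords {V : Type*} (C : V → Plane) : V × Fin 2 → ℝ :=
  fun k => C k.1 k.2

/-- The identification of the annotated placements with `ℝ^(V × 2 + E × E)`. -/
def annotatedCoords {V E : Type*} (p : AnnotatedPlacement V E) : (V × Fin 2) ⊕ (E × E) → ℝ :=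
  Sum.elim (placementCoords p.1) (fun k => p.2 k.1 k.2)

/-! Each of the five sets is described by a first-order formula over the ordered field of reals, so
everything rests on the Tarski–Seidenberg theorem (`IsSemialgebraic.exists_option_elim`) and on
finding these formulas.

A graph and a placement determine the bar lengths, so the quantifier over related linkages
disappears (`Linkage.exists_related_iff`). Nontouching quantifies over points of the plane and
parameters of segments; being joined by zero-length bars depends only on which of the finitely many
bars are degenerate. `Ord` is a difference of lengths of intervals, because the shadow of a segment
is a projection of a convex set, and such a length is first-order definable
(`IsSemialgebraicFun.volume_real`). Finally, the closure is a statement of the form "for all δ > 0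
there is a placement".

Elimination of one variable is proved by Cauchy indices. The sum of the signs of g over the roots of
p is the Cauchy index of p'g/p. The index of f/p is unchanged when f is reduced modulo p up to a
positive factor, and the indices of f/p and p/f add up to a quantity read off from degree and
leading coefficient. Euclid's algorithm thus computes it, and when the coefficients are polynomials
in x it branches only on polynomial sign conditions in x, so the index is a semialgebraic step
function of x. Combinations of such sums detect a root of p at which given polynomials are positive.
Strict inequalities without an equation reduce to this case, since they can be tested near ±∞ and at
critical points of their product. -/

/-! ### Sign jumps and the Cauchy index of real polynomials -/

section CauchyIndex

open Polynomial

namespace Polynomial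

/-- Half the jump of the sign of `h` at `t`. -/
noncomputable def signJump (h : ℝ[X]) (t : ℝ) : ℤ :=
  if Odd (h.rootMultiplicity t) then
    (SignType.sign ((h /ₘ (X - C t) ^ h.rootMultiplicity t).eval t) : ℤ) else 0

/-- Half the difference of the signs of `h` at `+∞` and at `-∞`. -/
noncomputable def endJump (h : ℝ[X]) : ℤ :=
  if Odd h.natDegree then (SignType.sign h.leadingCoeff : ℤ) else 0

theorem rootMultiplicity_X_sub_C_pow_mul {u : ℝ[X]} {t : ℝ} (hu : u.eval t ≠ 0) (m : ℕ) :
    ((X - C t) ^ m * u).rootMultiplicity t = m := by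
  have hu0 : u ≠ 0 := by rintro rfl; simp at hu
  have h0 : (X - C t) ^ m * u ≠ 0 := mul_ne_zero (pow_ne_zero _ (X_sub_C_ne_zero t)) hu0
  rw [rootMultiplicity_mul h0, rootMultiplicity_X_sub_C_pow,
    rootMultiplicity_eq_zero (by simpa [IsRoot] using hu), add_zero]

theorem signJump_X_sub_C_pow_mul {u : ℝ[X]} {t : ℝ} (hu : u.eval t ≠ 0) (m : ℕ) :
    signJump ((X - C t) ^ m * u) t = if Odd m then (SignType.sign (u.eval t) : ℤ) else 0 := by
  unfold signJump
  rw [rootMultiplicity_X_sub_C_pow_mul hu, mul_divByMonic_cancel_left _ ((monic_X_sub_C t).pow m)]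

theorem exists_eq_X_sub_C_pow_mul {h : ℝ[X]} (h0 : h ≠ 0) (t : ℝ) :
    ∃ m u, h = (X - C t) ^ m * u ∧ u.eval t ≠ 0 := by
  obtain ⟨u, hu, hd⟩ := exists_eq_pow_rootMultiplicity_mul_and_not_dvd h h0 t
  exact ⟨_, u, hu, fun h => hd (dvd_iff_isRoot.2 h)⟩

theorem sign_eval_eq_sign_leadingCoeff {u : ℝ[X]} {a : ℝ} (hu : ∀ t, a ≤ t → u.eval t ≠ 0) :
    SignType.sign (u.eval a) = SignType.sign u.leadingCoeff := by
  have key : ∀ v : ℝ[X], (∀ t, a ≤ t → v.eval t ≠ 0) → 0 < v.leadingCoeff → 0 < v.eval a := by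
    intro v hv hl
    by_contra hneg
    have hlt : v.eval a < 0 := lt_of_le_of_ne (not_lt.1 hneg) (hv a le_rfl)
    by_cases hd : 0 < v.degree
    · obtain ⟨b, hb, hab⟩ := ((v.tendsto_atTop_of_leadingCoeff_nonneg hd hl.le).eventually_gt_atTop 0
        |>.and (Filter.eventually_ge_atTop a)).exists
      obtain ⟨c, hc, hc0⟩ := intermediate_value_Icc hab v.continuous.continuousOn
        (show (0 : ℝ) ∈ Set.Icc _ _ from ⟨hlt.le, hb.le⟩)
      exact hv c hc.1 hc0
    · rw [eq_C_of_degree_le_zero (not_lt.1 hd)] at hl hlt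
      simp at hl hlt
      linarith
  have hu0 : u ≠ 0 := by rintro rfl; simpa using hu a le_rfl
  rcases lt_or_gt_of_ne (leadingCoeff_ne_zero.2 hu0) with h | h
  · have := key (-u) (by simpa using hu) (by simpa using h)
    rw [sign_neg h, sign_neg (by simpa using this)]
  · rw [sign_pos h, sign_pos (key u hu h)]

theorem leadingCoeff_comp_neg_X (u : ℝ[X]) :
    (u.comp (-X)).leadingCoeff = (-1) ^ u.natDegree * u.leadingCoeff := by
  rw [leadingCoeff_comp (by simp), leadingCoeff_neg, leadingCoeff_X, mul_comm]

theorem sign_eval_eq_sign_leadingCoeff_of_le {u : ℝ[X]} {a : ℝ} (hu : ∀ t, t ≤ a → u.eval t ≠ 0) :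
    SignType.sign (u.eval a) = SignType.sign ((-1) ^ u.natDegree * u.leadingCoeff) := by
  rw [← leadingCoeff_comp_neg_X, ← sign_eval_eq_sign_leadingCoeff (a := -a)]
  · simp
  · intro t ht
    simpa using hu (-t) (by linarith)

theorem even_natDegree_of_no_root {u : ℝ[X]} (hu : ∀ t, u.eval t ≠ 0) : Even u.natDegree := by
  by_contra hodd
  have h1 := sign_eval_eq_sign_leadingCoeff (a := 0) fun t _ => hu t
  rw [sign_eval_eq_sign_leadingCoeff_of_le fun t _ => hu t,
    (Nat.not_even_iff_odd.1 hodd).neg_one_pow, neg_one_mul, Left.sign_neg] at h1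
  have hu0 : u ≠ 0 := by rintro rfl; simpa using hu 0
  exact leadingCoeff_ne_zero.2 hu0 (sign_eq_zero_iff.1 (SignType.neg_eq_self_iff.1 h1))

/-- The sign is constant between consecutive roots, so the jumps telescope. The induction removes
the greatest root together with its multiplicity. -/
theorem sum_signJump (h : ℝ[X]) (h0 : h ≠ 0) :
    ∑ t ∈ h.roots.toFinset, signJump h t = endJump h := by
  induction hn : h.natDegree using Nat.strong_induction_on generalizing h with
  | _ n ih =>
  subst hn
  rcases h.roots.toFinset.eq_empty_or_nonempty with he | hne
  · have : Even h.natDegree := even_natDegree_of_no_root fun t ht => by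
      have : t ∈ h.roots.toFinset := by simpa [h0] using ht
      simp [he] at this
    rw [he, Finset.sum_empty, endJump, if_neg (Nat.not_odd_iff_even.2 this)]
  · obtain ⟨a, ha, hmax⟩ : ∃ a ∈ h.roots.toFinset, ∀ t ∈ h.roots.toFinset, t ≤ a :=
      ⟨_, Finset.max'_mem _ hne, Finset.le_max' _⟩
    obtain ⟨m, u, rfl, hua⟩ := exists_eq_X_sub_C_pow_mul h0 a
    have hu0 : u ≠ 0 := by rintro rfl; simp at hua
    have hm : m ≠ 0 := by
      rintro rfl
      simp [hu0] at ha
      exact hua ha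
    have hmem : ∀ t, t ∈ ((X - C a) ^ m * u).roots.toFinset ↔ t = a ∨ t ∈ u.roots.toFinset := by
      intro t
      simp [h0, hu0, hm, sub_eq_zero]
    have hroots : ((X - C a) ^ m * u).roots.toFinset = insert a u.roots.toFinset := by
      ext t
      rw [hmem, Finset.mem_insert]
    have hau : a ∉ u.roots.toFinset := by simpa [hu0] using hua
    have hdeg : ((X - C a) ^ m * u).natDegree = m + u.natDegree := by
      rw [natDegree_mul (pow_ne_zero _ (X_sub_C_ne_zero a)) hu0]
      simp
    have hlc : ((X - C a) ^ m * u).leadingCoeff = u.leadingCoeff := by simp [leadingCoeff_mul]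
    -- To the left of `a` the factor `(X - C a) ^ m` has sign `(-1) ^ m`.
    have hjump : ∀ t ∈ u.roots.toFinset,
        signJump ((X - C a) ^ m * u) t = (-1) ^ m * signJump u t := by
      intro t ht
      have hta : t < a := lt_of_le_of_ne (hmax t ((hmem t).2 (Or.inr ht)))
        (fun h => hau (h ▸ ht))
      obtain ⟨k, w, rfl, hw⟩ := exists_eq_X_sub_C_pow_mul hu0 t
      rw [mul_left_comm, signJump_X_sub_C_pow_mul hw, signJump_X_sub_C_pow_mul]
      · rw [eval_mul, sign_mul, eval_pow, sign_pow, eval_sub, eval_X, eval_C,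
          sign_neg (sub_neg.2 hta)]
        split_ifs <;> simp
      · simpa [hw, sub_eq_zero] using fun h => absurd h hta.ne
    have hsign : SignType.sign (u.eval a) = SignType.sign u.leadingCoeff := by
      refine sign_eval_eq_sign_leadingCoeff fun t hat ht => ?_
      have hut : t ∈ u.roots.toFinset := by simpa [hu0] using ht
      have := hmax t ((hmem t).2 (Or.inr hut))
      exact hau (le_antisymm this hat ▸ hut)
    rw [hroots, Finset.sum_insert hau, Finset.sum_congr rfl hjump, ← Finset.mul_sum,
      ih u.natDegree (by omega) u hu0 rfl, signJump_X_sub_C_pow_mul hua, endJump, endJump, hdeg,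
      hlc, hsign]
    rcases Nat.even_or_odd m with hm | hm
    · simp [hm.neg_one_pow, Nat.odd_add, Nat.not_odd_iff_even.2 hm]
    · simp only [hm, hm.neg_one_pow, Nat.odd_add]
      rcases Nat.even_or_odd u.natDegree with hu | hu
      · simp [hu, Nat.not_odd_iff_even.2 hu]
      · simp [hu, Nat.not_even_iff_odd.2 hu]

/-- The Cauchy index of the rational function `f / p`. -/
noncomputable def cauchyIndex (f p : ℝ[X]) : ℤ :=
  ∑ t ∈ p.roots.toFinset,
    open Classical in if (X - C t) ^ p.rootMultiplicity t ∣ f then 0 else signJump (f * p) t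

theorem cauchyIndex_of_natDegree_eq_zero {p : ℝ[X]} (hp : p.natDegree = 0) (f : ℝ[X]) :
    cauchyIndex f p = 0 := by
  rw [eq_C_of_natDegree_eq_zero hp, cauchyIndex]
  simp

theorem cauchyIndex_zero_left (p : ℝ[X]) : cauchyIndex 0 p = 0 := by
  simp [cauchyIndex]

theorem X_sub_C_pow_dvd_X_sub_C_pow_mul_iff {u : ℝ[X]} {t : ℝ} (hu : u.eval t ≠ 0) (m k : ℕ) :
    (X - C t) ^ k ∣ (X - C t) ^ m * u ↔ k ≤ m := by
  have hu0 : u ≠ 0 := by rintro rfl; simp at hu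
  have h0 : (X - C t) ^ m * u ≠ 0 := mul_ne_zero (pow_ne_zero _ (X_sub_C_ne_zero t)) hu0
  rw [← le_rootMultiplicity_iff h0, rootMultiplicity_X_sub_C_pow_mul hu]

/-- The inversion step of Euclid's algorithm. A common root of unequal orders is a pole of exactly
one of f/p and p/f; at equal orders neither has a pole, and fp has even order, hence no jump. So
every jump of fp is counted once. -/
theorem cauchyIndex_add_cauchyIndex {f p : ℝ[X]} (hf : f ≠ 0) (hp : p ≠ 0) :
    cauchyIndex f p + cauchyIndex p f = endJump (f * p) := by
  classical
  have h0 : f * p ≠ 0 := mul_ne_zero hf hp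
  -- The sum may run over all roots of the product: at a point that is not a root of p the exponent
  -- is 0 and the divisibility holds trivially.
  have hsub : ∀ f p : ℝ[X], f ≠ 0 → p ≠ 0 → cauchyIndex f p = ∑ t ∈ (f * p).roots.toFinset,
      if (X - C t) ^ p.rootMultiplicity t ∣ f then 0 else signJump (f * p) t := by
    intro f p hf hp
    unfold cauchyIndex
    have hs : p.roots.toFinset ⊆ (f * p).roots.toFinset := by
      intro t
      simp only [Multiset.mem_toFinset, mem_roots (mul_ne_zero hf hp), mem_roots hp]
      intro ht
      exact root_mul_left_of_isRoot f ht
    refine (Finset.sum_subset hs fun t _ ht => ?_).trans (Finset.sum_congr rfl fun t _ => ?_)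
    · have : p.rootMultiplicity t = 0 := by
        rw [rootMultiplicity_eq_zero]
        simpa [hp] using ht
      simp [this]
    · congr
  rw [hsub f p hf hp, hsub p f hp hf, mul_comm p f, ← Finset.sum_add_distrib, ← sum_signJump _ h0]
  refine Finset.sum_congr rfl fun t _ => ?_
  obtain ⟨m, u, rfl, hu⟩ := exists_eq_X_sub_C_pow_mul hf t
  obtain ⟨k, w, rfl, hw⟩ := exists_eq_X_sub_C_pow_mul hp t
  have hprod : (X - C t) ^ m * u * ((X - C t) ^ k * w) = (X - C t) ^ (m + k) * (u * w) := by ring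
  rw [rootMultiplicity_X_sub_C_pow_mul hu, rootMultiplicity_X_sub_C_pow_mul hw,
    X_sub_C_pow_dvd_X_sub_C_pow_mul_iff hu, X_sub_C_pow_dvd_X_sub_C_pow_mul_iff hw, hprod,
    signJump_X_sub_C_pow_mul (by simp [hu, hw])]
  rcases lt_trichotomy m k with h | h | h
  · simp [h.not_ge, h.le]
  · simp [h]
  · simp [h.not_ge, h.le]

/-- The division step of Euclid's algorithm: f/p is scaled by a positive constant and changed by a
polynomial, which affects neither the poles nor the signs of the jumps there. -/
theorem cauchyIndex_C_mul_add_mul {a : ℝ} (ha : 0 < a) (f k p : ℝ[X]) :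
    cauchyIndex (C a * f + k * p) p = cauchyIndex f p := by
  classical
  unfold cauchyIndex
  refine Finset.sum_congr rfl fun t ht => ?_
  have hp : p ≠ 0 := by rintro rfl; simp at ht
  have hu : IsUnit (C a) := isUnit_C.2 ha.ne'.isUnit
  have hd : (X - C t) ^ p.rootMultiplicity t ∣ C a * f + k * p ↔
      (X - C t) ^ p.rootMultiplicity t ∣ f :=
    (dvd_add_left ((pow_rootMultiplicity_dvd p t).mul_left k)).trans hu.dvd_mul_left
  by_cases hf : (X - C t) ^ p.rootMultiplicity t ∣ f
  · rw [if_pos hf, if_pos (hd.2 hf)]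
  rw [if_neg hf, if_neg (mt hd.1 hf)]
  have hf0 : f ≠ 0 := by rintro rfl; exact hf (dvd_zero _)
  obtain ⟨j, v, rfl, hv⟩ := exists_eq_X_sub_C_pow_mul hf0 t
  obtain ⟨m, w, rfl, hw⟩ := exists_eq_X_sub_C_pow_mul hp t
  rw [rootMultiplicity_X_sub_C_pow_mul hw, X_sub_C_pow_dvd_X_sub_C_pow_mul_iff hv, not_le] at hf
  obtain ⟨i, rfl⟩ := Nat.exists_eq_add_of_lt hf
  have h1 : (C a * ((X - C t) ^ j * v) + k * ((X - C t) ^ (j + i + 1) * w)) *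
      ((X - C t) ^ (j + i + 1) * w) = (X - C t) ^ (j + (j + i + 1)) *
        ((C a * v + (X - C t) ^ (i + 1) * (k * w)) * w) := by ring
  have h2 : (X - C t) ^ j * v * ((X - C t) ^ (j + i + 1) * w) =
      (X - C t) ^ (j + (j + i + 1)) * (v * w) := by ring
  have h3 : ((C a * v + (X - C t) ^ (i + 1) * (k * w)) * w).eval t = a * (v * w).eval t := by
    simp [mul_assoc]
  have h4 : (v * w).eval t ≠ 0 := by simp [hv, hw]
  rw [h1, h2, signJump_X_sub_C_pow_mul h4, signJump_X_sub_C_pow_mul, h3, sign_mul, sign_pos ha,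
    one_mul]
  rw [h3]
  exact mul_ne_zero ha.ne' h4

/-- The Tarski query: the sum of the signs of `g` over the roots of `p`. -/
theorem cauchyIndex_derivative_mul {p : ℝ[X]} (hp : p ≠ 0) (g : ℝ[X]) :
    cauchyIndex (derivative p * g) p = ∑ t ∈ p.roots.toFinset, (SignType.sign (g.eval t) : ℤ) := by
  classical
  unfold cauchyIndex
  refine Finset.sum_congr rfl fun t ht => ?_
  obtain ⟨m, u, rfl, hu⟩ := exists_eq_X_sub_C_pow_mul hp t
  obtain ⟨k, rfl⟩ : ∃ k, m = k + 1 := by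
    refine Nat.exists_eq_succ_of_ne_zero ?_
    rintro rfl
    simp at ht
    exact hu (by simpa using ht.2)
  -- If g does not vanish at `t`, then p'g/p has a simple pole there. The product of numerator and
  -- denominator has odd order 2k+1, with cofactor of value (k+1)u(t)²g(t), so the jump is the sign
  -- of g(t). If g(t) = 0, the pole cancels.
  set w : ℝ[X] := C ((k : ℝ) + 1) * u + (X - C t) * derivative u with hw
  have hd : derivative ((X - C t) ^ (k + 1) * u) = (X - C t) ^ k * w := by
    rw [derivative_mul, derivative_X_sub_C_pow, hw]
    simp
    ring
  have hwt : w.eval t = (k + 1) * u.eval t := by simp [hw]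
  have hk : (0 : ℝ) < k + 1 := by positivity
  rw [rootMultiplicity_X_sub_C_pow_mul hu, hd]
  by_cases hg : g.eval t = 0
  · have : (X - C t) ^ (k + 1) ∣ (X - C t) ^ k * w * g := by
      rw [pow_succ]
      exact mul_dvd_mul (dvd_mul_right _ _) (dvd_iff_isRoot.2 hg)
    simp [this, hg]
  · have hne : (w * g).eval t ≠ 0 := by
      rw [eval_mul, hwt]
      exact mul_ne_zero (mul_ne_zero hk.ne' hu) hg
    have h2 : (X - C t) ^ k * w * g * ((X - C t) ^ (k + 1) * u) =
        (X - C t) ^ (k + (k + 1)) * (w * g * u) := by ring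
    have h3 : ¬ (X - C t) ^ (k + 1) ∣ (X - C t) ^ k * w * g := by
      rw [mul_assoc, X_sub_C_pow_dvd_X_sub_C_pow_mul_iff hne]
      omega
    rw [if_neg h3, h2, signJump_X_sub_C_pow_mul (by rw [eval_mul]; exact mul_ne_zero hne hu),
      if_pos ⟨k, by ring⟩]
    have : (w * g * u).eval t = ((k + 1) * u.eval t ^ 2) * g.eval t := by
      rw [eval_mul, eval_mul, hwt]; ring
    rw [this, sign_mul, sign_pos (mul_pos hk (by positivity)), one_mul]

end Polynomial

end CauchyIndex

/-! ### Boolean combinations and semialgebraic step functions -/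

namespace IsSemialgebraic

variable {ι κ : Type*}

theorem empty : IsSemialgebraic (∅ : Set (ι → ℝ)) := by
  simpa using lt_zero (0 : MvPolynomial ι ℝ)

theorem univ : IsSemialgebraic (Set.univ : Set (ι → ℝ)) := by
  simpa using eq_zero (0 : MvPolynomial ι ℝ)

theorem const (p : Prop) : IsSemialgebraic {_x : ι → ℝ | p} := by
  by_cases h : p
  · simpa [h] using univ
  · simpa [h] using empty

theorem biUnion {s : Set κ} (hs : s.Finite) {S : κ → Set (ι → ℝ)}
    (hS : ∀ i ∈ s, IsSemialgebraic (S i)) : IsSemialgebraic (⋃ i ∈ s, S i) := by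
  induction s, hs using Set.Finite.induction_on with
  | empty => simpa using empty
  | insert _ _ ih =>
    rw [Set.biUnion_insert]
    exact (hS _ (Set.mem_insert _ _)).union (ih fun i hi => hS i (Set.mem_insert_of_mem _ hi))

theorem iUnion [Finite κ] {S : κ → Set (ι → ℝ)} (hS : ∀ i, IsSemialgebraic (S i)) :
    IsSemialgebraic (⋃ i, S i) := by
  simpa using biUnion Set.finite_univ fun i _ => hS i

theorem biInter {s : Set κ} (hs : s.Finite) {S : κ → Set (ι → ℝ)}
    (hS : ∀ i ∈ s, IsSemialgebraic (S i)) : IsSemialgebraic (⋂ i ∈ s, S i) := by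
  simpa [Set.compl_iUnion] using (biUnion hs fun i hi => (hS i hi).compl).compl

theorem iInter [Finite κ] {S : κ → Set (ι → ℝ)} (hS : ∀ i, IsSemialgebraic (S i)) :
    IsSemialgebraic (⋂ i, S i) := by
  simpa using biInter Set.finite_univ fun i _ => hS i

/-- Membership in a semialgebraic set is decided by the signs of finitely many polynomials. -/
theorem exists_finset_sign {S : Set (ι → ℝ)} (hS : IsSemialgebraic S) :
    ∃ s : Finset (MvPolynomial ι ℝ), ∀ x y : ι → ℝ,
      (∀ p ∈ s, SignType.sign (p.eval x) = SignType.sign (p.eval y)) → (x ∈ S ↔ y ∈ S) := by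
  classical
  induction hS with
  | eq_zero f =>
    refine ⟨{f}, fun x y h => ?_⟩
    have := h f (by simp)
    rw [Set.mem_ofPred_eq, Set.mem_ofPred_eq, ← sign_eq_zero_iff, this, sign_eq_zero_iff]
  | lt_zero f =>
    refine ⟨{f}, fun x y h => ?_⟩
    have := h f (by simp)
    rw [Set.mem_ofPred_eq, Set.mem_ofPred_eq, ← sign_eq_neg_one_iff, this, sign_eq_neg_one_iff]
  | compl _ ih =>
    obtain ⟨s, hs⟩ := ih
    exact ⟨s, fun x y h => not_congr (hs x y h)⟩
  | union _ _ ih₁ ih₂ =>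
    obtain ⟨s, hs⟩ := ih₁
    obtain ⟨t, ht⟩ := ih₂
    exact ⟨s ∪ t, fun x y h => or_congr (hs x y fun p hp => h p (Finset.mem_union_left _ hp))
      (ht x y fun p hp => h p (Finset.mem_union_right _ hp))⟩
  | inter _ _ ih₁ ih₂ =>
    obtain ⟨s, hs⟩ := ih₁
    obtain ⟨t, ht⟩ := ih₂
    exact ⟨s ∪ t, fun x y h => and_congr (hs x y fun p hp => h p (Finset.mem_union_left _ hp))
      (ht x y fun p hp => h p (Finset.mem_union_right _ hp))⟩

end IsSemialgebraic

/-- An integer-valued function with finitely many values and semialgebraic fibres. -/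
def IsSemialgebraicStep {ι : Type*} (g : (ι → ℝ) → ℤ) : Prop :=
  (Set.range g).Finite ∧ ∀ A : Set ℤ, IsSemialgebraic (g ⁻¹' A)

namespace IsSemialgebraicStep

variable {ι κ : Type*} {f g h : (ι → ℝ) → ℤ}

theorem const (n : ℤ) : IsSemialgebraicStep fun _ : ι → ℝ => n :=
  ⟨Set.finite_range_const, fun _ => IsSemialgebraic.const _⟩

theorem cases {S : Set (ι → ℝ)} (hS : IsSemialgebraic S) (hf : IsSemialgebraicStep f)
    (hg : IsSemialgebraicStep g) (h₁ : ∀ x ∈ S, h x = f x) (h₂ : ∀ x ∉ S, h x = g x) :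
    IsSemialgebraicStep h := by
  refine ⟨(hf.1.union hg.1).subset ?_, fun A => ?_⟩
  · rintro _ ⟨x, rfl⟩
    by_cases hx : x ∈ S
    · exact Or.inl ⟨x, (h₁ x hx).symm⟩
    · exact Or.inr ⟨x, (h₂ x hx).symm⟩
  · convert (hS.inter (hf.2 A)).union (hS.compl.inter (hg.2 A)) using 1
    ext x
    by_cases hx : x ∈ S
    · simp [hx, h₁ x hx]
    · simp [hx, h₂ x hx]

theorem comp₂ (φ : ℤ → ℤ → ℤ) (hf : IsSemialgebraicStep f) (hg : IsSemialgebraicStep g) :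
    IsSemialgebraicStep fun x => φ (f x) (g x) := by
  refine ⟨(Set.Finite.image2 φ hf.1 hg.1).subset ?_, fun A => ?_⟩
  · rintro _ ⟨x, rfl⟩
    exact ⟨_, ⟨x, rfl⟩, _, ⟨x, rfl⟩, rfl⟩
  · have : (fun x => φ (f x) (g x)) ⁻¹' A =
        ⋃ i ∈ Set.range f, f ⁻¹' {i} ∩ g ⁻¹' {j | φ i j ∈ A} := by
      ext x
      simp only [Set.mem_preimage, Set.mem_iUnion, Set.mem_inter_iff, Set.mem_singleton_iff,
        exists_prop]
      exact ⟨fun h => ⟨f x, ⟨x, rfl⟩, rfl, h⟩, fun ⟨_, _, hi, h⟩ => hi ▸ h⟩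
    rw [this]
    exact IsSemialgebraic.biUnion hf.1 fun i _ => (hf.2 _).inter (hg.2 _)

theorem sub (hf : IsSemialgebraicStep f) (hg : IsSemialgebraicStep g) :
    IsSemialgebraicStep fun x => f x - g x := comp₂ (· - ·) hf hg

theorem sum (s : Finset κ) {f : κ → (ι → ℝ) → ℤ} (hf : ∀ i ∈ s, IsSemialgebraicStep (f i)) :
    IsSemialgebraicStep fun x => ∑ i ∈ s, f i x := by
  classical
  induction s using Finset.induction_on with
  | empty => simpa using const 0
  | insert i s hi ih =>
    simp only [Finset.sum_insert hi]
    exact comp₂ (· + ·) (hf i (Finset.mem_insert_self _ _))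
      (ih fun j hj => hf j (Finset.mem_insert_of_mem hj))

theorem cases_zero (q : MvPolynomial ι ℝ) (hf : IsSemialgebraicStep f)
    (hg : IsSemialgebraicStep g) (h₁ : ∀ x, q.eval x = 0 → h x = f x)
    (h₂ : ∀ x, q.eval x ≠ 0 → h x = g x) : IsSemialgebraicStep h :=
  cases (IsSemialgebraic.eq_zero q) hf hg h₁ h₂

theorem of_sign (φ : SignType → ℤ) (p : MvPolynomial ι ℝ) :
    IsSemialgebraicStep fun x => φ (SignType.sign (p.eval x)) := by
  classical
  have h : IsSemialgebraicStep fun x => if p.eval x < 0 then φ (-1) else φ 1 :=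
    cases (IsSemialgebraic.lt_zero p) (const (φ (-1))) (const (φ 1))
      (fun x hx => if_pos hx) fun x hx => if_neg hx
  refine cases_zero p (const (φ 0)) h (fun x hx => by simp [hx]) fun x hx => ?_
  rcases lt_or_gt_of_ne hx with h | h
  · simp [h]
  · simp [h, h.not_gt]

end IsSemialgebraicStep

/-! ### Families of univariate polynomials -/

section Families

open Polynomial

variable {ι κ : Type*}

/-- The member at `x` of a polynomial family of univariate polynomials. -/
noncomputable abbrev Polynomial.specialize (P : (MvPolynomial ι ℝ)[X]) (x : ι → ℝ) : ℝ[X] :=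
  P.map (MvPolynomial.eval x)

/-- This makes the case distinction on the vanishing of a leading coefficient terminate: on the zero
set the polynomial can be shortened, and off it the degree is the formal one. -/
theorem Polynomial.specialize_eraseLead {P : (MvPolynomial ι ℝ)[X]} {x : ι → ℝ}
    (hx : MvPolynomial.eval x P.leadingCoeff = 0) : P.eraseLead.specialize x = P.specialize x := by
  conv_rhs => rw [← P.eraseLead_add_C_mul_X_pow]
  rw [specialize, specialize, Polynomial.map_add, Polynomial.map_mul, Polynomial.map_C, hx]
  simp

namespace IsSemialgebraicStep

theorem of_lead (φ : ℕ → SignType → ℤ) (P : (MvPolynomial ι ℝ)[X]) :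
    IsSemialgebraicStep fun x =>
      φ (P.specialize x).natDegree (SignType.sign (P.specialize x).leadingCoeff) := by
  induction hn : P.support.card using Nat.strong_induction_on generalizing P with
  | _ n ih =>
  subst hn
  by_cases hP : P = 0
  · subst hP
    simpa using const _
  · refine cases_zero P.leadingCoeff
      (ih _ (eraseLead_support_card_lt hP) _ rfl) (of_sign (φ P.natDegree) P.leadingCoeff)
      (fun x hx => ?_) fun x hx => ?_
    · rw [specialize_eraseLead hx]
    · rw [natDegree_map_of_leadingCoeff_ne_zero _ hx, leadingCoeff_map_of_leadingCoeff_ne_zero _ hx]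

theorem endJump (P : (MvPolynomial ι ℝ)[X]) :
    IsSemialgebraicStep fun x => (P.specialize x).endJump := by
  exact of_lead (fun n s => if Odd n then (s : ℤ) else 0) P

/-- One step of pseudo-division. -/
theorem _root_.Polynomial.exists_pseudoRemainder {R : Type*} [CommRing R] [IsDomain R]
    {f p : R[X]} (hp : p.natDegree ≤ f.natDegree) (hf : 0 < f.natDegree) :
    ∃ r k : R[X], r.natDegree < f.natDegree ∧ r = C (p.leadingCoeff ^ 2) * f + k * p := by
  -- The multiplier is a square, so it specializes to a positive number wherever the leading
  -- coefficient of `p` does not vanish; `k` is chosen to cancel the coefficient at the degree of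
  -- `f`.
  refine ⟨_, -(C (p.leadingCoeff * f.leadingCoeff) * X ^ (f.natDegree - p.natDegree)), ?_, rfl⟩
  have hk : (C (p.leadingCoeff ^ 2) * f).natDegree ≤ f.natDegree := natDegree_C_mul_le _ _
  have hk' : (-(C (p.leadingCoeff * f.leadingCoeff) * X ^ (f.natDegree - p.natDegree)) * p).natDegree
      ≤ f.natDegree := by
    refine natDegree_mul_le.trans ?_
    rw [natDegree_neg]
    have := natDegree_C_mul_X_pow_le (p.leadingCoeff * f.leadingCoeff) (f.natDegree - p.natDegree)
    omega
  refine lt_of_le_of_ne (natDegree_add_le_of_degree_le hk hk') fun h => ?_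
  have h0 : (C (p.leadingCoeff ^ 2) * f +
      -(C (p.leadingCoeff * f.leadingCoeff) * X ^ (f.natDegree - p.natDegree)) * p).coeff
        f.natDegree = 0 := by
    have h1 : (X ^ (f.natDegree - p.natDegree) * p).coeff f.natDegree = p.leadingCoeff := by
      rw [coeff_X_pow_mul', if_pos (Nat.sub_le _ _), Nat.sub_sub_self hp, coeff_natDegree]
    rw [coeff_add, coeff_C_mul, neg_mul, coeff_neg, mul_assoc, coeff_C_mul, h1]
    simp only [coeff_natDegree]
    ring
  have h0 := (congrArg (coeff _) h).trans h0
  rw [coeff_natDegree, leadingCoeff_eq_zero] at h0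
  rw [h0, natDegree_zero] at h
  omega

/-- Euclid's algorithm run uniformly in x, by induction on the sum of the formal degrees. A
vanishing leading coefficient is erased; otherwise `f` is reduced modulo `p`, or, if `f` has the
smaller degree, the fraction is inverted at the cost of an end jump and `p` is reduced modulo `f`.
-/
theorem cauchyIndex (f p : (MvPolynomial ι ℝ)[X]) :
    IsSemialgebraicStep fun x => (f.specialize x).cauchyIndex (p.specialize x) := by
  induction hn : f.natDegree + p.natDegree using Nat.strong_induction_on generalizing f p with
  | _ n ih =>
  subst hn
  have hconst : ∀ f p : (MvPolynomial ι ℝ)[X], p.natDegree = 0 → ∀ x,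
      (f.specialize x).cauchyIndex (p.specialize x) = 0 := fun f p hp x =>
    cauchyIndex_of_natDegree_eq_zero (Nat.le_zero.1 ((natDegree_map_le).trans hp.le)) _
  have herase : ∀ q : (MvPolynomial ι ℝ)[X], 0 < q.natDegree →
      q.eraseLead.natDegree < q.natDegree := by
    intro q hq
    rcases q.eraseLead_natDegree_lt_or_eraseLead_eq_zero with h | h
    · exact h
    · simpa [h] using hq
  have hstep : ∀ f p r k : (MvPolynomial ι ℝ)[X], r = C (p.leadingCoeff ^ 2) * f + k * p → ∀ x,
      MvPolynomial.eval x p.leadingCoeff ≠ 0 →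
      (f.specialize x).cauchyIndex (p.specialize x) =
        (r.specialize x).cauchyIndex (p.specialize x) := by
    rintro f p r k rfl x hx
    rw [← cauchyIndex_C_mul_add_mul (sq_pos_of_ne_zero hx) (f.specialize x) (k.specialize x)]
    simp [specialize]
  rcases Nat.eq_zero_or_pos p.natDegree with hp | hp
  · simpa only [hconst f p hp] using const 0
  obtain ⟨g, hg, hgx⟩ : ∃ g, IsSemialgebraicStep g ∧ ∀ x, MvPolynomial.eval x p.leadingCoeff ≠ 0 →
      (f.specialize x).cauchyIndex (p.specialize x) = g x := by
    rcases le_or_gt p.natDegree f.natDegree with hpf | hpf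
    · obtain ⟨r, k, hr, hrk⟩ := exists_pseudoRemainder hpf (hp.trans_le hpf)
      exact ⟨_, ih _ (Nat.add_lt_add_right hr _) r p rfl, hstep f p r k hrk⟩
    obtain ⟨l, hl, hlx⟩ : ∃ l, IsSemialgebraicStep l ∧
        ∀ x, MvPolynomial.eval x f.leadingCoeff = 0 →
          (f.specialize x).cauchyIndex (p.specialize x) = l x := by
      rcases Nat.eq_zero_or_pos f.natDegree with hf | hf
      · refine ⟨_, const 0, fun x hx => ?_⟩
        rw [eq_C_of_natDegree_eq_zero hf, leadingCoeff_C] at hx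
        rw [eq_C_of_natDegree_eq_zero hf, specialize, map_C, hx, C_0, cauchyIndex_zero_left]
      · refine ⟨_, ih _ (Nat.add_lt_add_right (herase f hf) _) f.eraseLead p rfl, fun x hx => ?_⟩
        rw [specialize_eraseLead hx]
    obtain ⟨u, hu, hux⟩ : ∃ u, IsSemialgebraicStep u ∧
        ∀ x, MvPolynomial.eval x f.leadingCoeff ≠ 0 →
          (p.specialize x).cauchyIndex (f.specialize x) = u x := by
      rcases Nat.eq_zero_or_pos f.natDegree with hf | hf
      · exact ⟨_, const 0, fun x _ => hconst p f hf x⟩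
      · obtain ⟨r, k, hr, hrk⟩ := exists_pseudoRemainder hpf.le hp
        exact ⟨_, ih _ (by omega) r f rfl, hstep p f r k hrk⟩
    classical
    refine ⟨fun x => if MvPolynomial.eval x f.leadingCoeff = 0 then l x else
      ((f * p).specialize x).endJump - u x, cases_zero f.leadingCoeff hl ((endJump (f * p)).sub hu)
        (fun x hx => if_pos hx) (fun x hx => if_neg hx), fun x hx => ?_⟩
    beta_reduce
    split_ifs with hf
    · exact hlx x hf
    · have hf0 : f.specialize x ≠ 0 := fun h => hf (by
        simpa [eq_comm] using congrArg (coeff · f.natDegree) h)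
      have hp0 : p.specialize x ≠ 0 := fun h => hx (by
        simpa [eq_comm] using congrArg (coeff · p.natDegree) h)
      rw [← hux x hf, show (f * p).specialize x = f.specialize x * p.specialize x from
        Polynomial.map_mul _]
      exact eq_sub_of_add_eq (cauchyIndex_add_cauchyIndex hf0 hp0)
  refine cases_zero p.leadingCoeff (ih _ (Nat.add_lt_add_left (herase p hp) _) f p.eraseLead rfl)
    hg (fun x hx => ?_) hgx
  rw [specialize_eraseLead hx]

end IsSemialgebraicStep

end Families

/-! ### Projections of semialgebraic sets -/

section Projection

open Polynomial Filter

variable {ι κ : Type*}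

/-! ### Sign conditions on finitely many univariate polynomials -/

namespace Polynomial

/-- Expanding the product of the σ² + σ over the subsets `S` of factors that contribute a square
turns each term into one Tarski query. -/
theorem sum_prod_sign_sq_add_sign (p : ℝ[X]) (hp : p ≠ 0) (s : Finset κ) (g : κ → ℝ[X]) :
    open Classical in
    ∑ S ∈ s.powerset, cauchyIndex (derivative p * ((∏ i ∈ S, g i ^ 2) * ∏ i ∈ s \ S, g i)) p =
      ∑ t ∈ p.roots.toFinset, ∏ i ∈ s, ((SignType.sign ((g i).eval t) : ℤ) ^ 2 +
        (SignType.sign ((g i).eval t) : ℤ)) := by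
  classical
  simp only [cauchyIndex_derivative_mul hp, Finset.prod_add]
  rw [Finset.sum_comm]
  refine Finset.sum_congr rfl fun t _ => Finset.sum_congr rfl fun S _ => ?_
  have hprod : ∀ (T : Finset κ) (a : κ → ℝ),
      (SignType.sign (∏ i ∈ T, a i) : ℤ) = ∏ i ∈ T, (SignType.sign (a i) : ℤ) := by
    intro T a
    induction T using Finset.induction_on with
    | empty => simp
    | insert i T hi ih =>
      rw [Finset.prod_insert hi, Finset.prod_insert hi, sign_mul, SignType.coe_mul, ih]
  rw [eval_mul, sign_mul, SignType.coe_mul, eval_prod, eval_prod, hprod, hprod]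
  simp [sign_pow]

/-- For a sign σ, the number σ² + σ is 2 if σ = 1 and 0 otherwise. Hence the sum is a positive
multiple of the number of roots of p at which all `g i` are positive. -/
theorem exists_root_forall_pos_iff (p : ℝ[X]) (hp : p ≠ 0) (s : Finset κ) (g : κ → ℝ[X]) :
    open Classical in
    (∃ t, p.eval t = 0 ∧ ∀ i ∈ s, 0 < (g i).eval t) ↔
    ∑ S ∈ s.powerset,
      cauchyIndex (derivative p * ((∏ i ∈ S, g i ^ 2) * ∏ i ∈ s \ S, g i)) p ≠ 0 := by
  rw [sum_prod_sign_sq_add_sign p hp]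
  have hnn : ∀ a : ℝ, 0 ≤ (SignType.sign a : ℤ) ^ 2 + (SignType.sign a : ℤ) := by
    intro a
    rcases lt_trichotomy a 0 with h | h | h <;> simp [h]
  have hne : ∀ a : ℝ, (SignType.sign a : ℤ) ^ 2 + (SignType.sign a : ℤ) ≠ 0 ↔ 0 < a := by
    intro a
    rcases lt_trichotomy a 0 with h | h | h <;> simp [h, h.le]
  rw [Ne, Finset.sum_eq_zero_iff_of_nonneg fun t _ => Finset.prod_nonneg fun i _ => hnn _]
  push Not
  simp only [Finset.prod_ne_zero_iff, hne, Multiset.mem_toFinset, mem_roots hp, IsRoot.def]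

theorem exists_forall_pos_of_leadingCoeff (s : Finset κ) (g : κ → ℝ[X])
    (h : ∀ i ∈ s, 0 < (g i).leadingCoeff) : ∃ t, ∀ i ∈ s, 0 < (g i).eval t := by
  have : ∀ᶠ t in atTop, ∀ i ∈ s, ∀ y, t ≤ y → ¬ (g i).IsRoot y := by
    rw [eventually_all_finset]
    intro i hi
    refine eventually_forall_ge_atTop.2 (eventually_atTop_not_isRoot _ ?_)
    rintro h0
    simpa [h0] using h i hi
  obtain ⟨t, ht⟩ := this.exists
  refine ⟨t, fun i hi => ?_⟩
  rw [← sign_eq_one_iff, sign_eval_eq_sign_leadingCoeff (ht i hi), sign_pos (h i hi)]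

theorem exists_forall_pos_of_leadingCoeff_neg (s : Finset κ) (g : κ → ℝ[X])
    (h : ∀ i ∈ s, 0 < (-1) ^ (g i).natDegree * (g i).leadingCoeff) :
    ∃ t, ∀ i ∈ s, 0 < (g i).eval t := by
  obtain ⟨t, ht⟩ := exists_forall_pos_of_leadingCoeff s (fun i => (g i).comp (-X))
    fun i hi => by simpa only [leadingCoeff_comp_neg_X] using h i hi
  exact ⟨-t, fun i hi => by simpa using ht i hi⟩

theorem eval_pos_of_no_root {p : ℝ[X]} {a b : ℝ} (h : ∀ y ∈ Set.uIcc a b, p.eval y ≠ 0)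
    (ha : 0 < p.eval a) : 0 < p.eval b := by
  by_contra hb
  obtain ⟨c, hc, hc0⟩ := intermediate_value_uIcc (a := a) (b := b) p.continuous.continuousOn
    (show (0 : ℝ) ∈ Set.uIcc _ _ from Set.mem_uIcc.2 (Or.inr ⟨not_lt.1 hb, ha.le⟩))
  exact h c hc hc0

/-- Where finitely many polynomials are simultaneously positive, they are so at infinity, at minus
infinity, or at a critical point of their product. -/
theorem exists_forall_pos_iff (s : Finset κ) (g : κ → ℝ[X]) :
    (∃ t, ∀ i ∈ s, 0 < (g i).eval t) ↔
      (∀ i ∈ s, 0 < (g i).leadingCoeff) ∨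
      (∀ i ∈ s, 0 < (-1) ^ (g i).natDegree * (g i).leadingCoeff) ∨
      (derivative (∏ i ∈ s, g i) ≠ 0 ∧
        ∃ t, (derivative (∏ i ∈ s, g i)).eval t = 0 ∧ ∀ i ∈ s, 0 < (g i).eval t) := by
  constructor
  swap
  · rintro (h | h | ⟨-, t, -, h⟩)
    · exact exists_forall_pos_of_leadingCoeff s g h
    · exact exists_forall_pos_of_leadingCoeff_neg s g h
    · exact ⟨t, h⟩
  rintro ⟨t, ht⟩
  set P := ∏ i ∈ s, g i with hP
  have hroot : ∀ {y}, P.eval y ≠ 0 → ∀ i ∈ s, (g i).eval y ≠ 0 := by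
    intro y hy
    rw [hP, eval_prod] at hy
    exact Finset.prod_ne_zero_iff.1 hy
  have hPt : P.eval t ≠ 0 := by
    rw [hP, eval_prod]
    exact Finset.prod_ne_zero_iff.2 fun i hi => (ht i hi).ne'
  have hP0 : P ≠ 0 := by
    intro h
    simp [h] at hPt
  by_cases h1 : ∀ y, t ≤ y → P.eval y ≠ 0
  · left
    intro i hi
    rw [← sign_eq_one_iff, ← sign_eval_eq_sign_leadingCoeff fun y hy => hroot (h1 y hy) i hi,
      sign_pos (ht i hi)]
  by_cases h2 : ∀ y, y ≤ t → P.eval y ≠ 0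
  · right; left
    intro i hi
    rw [← sign_eq_one_iff, ← sign_eval_eq_sign_leadingCoeff_of_le fun y hy => hroot (h2 y hy) i hi,
      sign_pos (ht i hi)]
  right; right
  push Not at h1 h2
  -- Here `t` lies strictly between consecutive roots `a` and `b` of the product. Rolle's theorem
  -- gives a critical point between them, and no `g i` changes sign on the way from `t` to it.
  obtain ⟨b, ⟨htb, hb⟩, hbmin⟩ : ∃ b, (t ≤ b ∧ P.eval b = 0) ∧
      ∀ y, t ≤ y → P.eval y = 0 → b ≤ y := by
    obtain ⟨b, hb, hmin⟩ := Finset.exists_min_image (P.roots.toFinset.filter (t ≤ ·)) id (by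
      obtain ⟨y, hy⟩ := h1
      exact ⟨y, by simpa [hP0] using hy.symm⟩)
    simp [hP0] at hb hmin
    exact ⟨b, hb.symm, fun y h h' => hmin y h' h⟩
  obtain ⟨a, ⟨hta, ha⟩, hamax⟩ : ∃ a, (a ≤ t ∧ P.eval a = 0) ∧
      ∀ y, y ≤ t → P.eval y = 0 → y ≤ a := by
    obtain ⟨b, hb, hmin⟩ := Finset.exists_max_image (P.roots.toFinset.filter (· ≤ t)) id (by
      obtain ⟨y, hy⟩ := h2
      exact ⟨y, by simpa [hP0] using hy.symm⟩)
    simp [hP0] at hb hmin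
    exact ⟨b, hb.symm, fun y h h' => hmin y h' h⟩
  have hat : a < t := lt_of_le_of_ne hta (by rintro rfl; exact hPt ha)
  have htb : t < b := lt_of_le_of_ne htb (by rintro rfl; exact hPt hb)
  have hno : ∀ y, a < y → y < b → P.eval y ≠ 0 := by
    intro y hay hyb hy
    rcases le_total t y with h | h
    · exact (hbmin y h hy).not_gt hyb
    · exact (hamax y h hy).not_gt hay
  -- A vanishing derivative would make the product constant, although it is zero at `a` and not at
  -- `t`.
  refine ⟨fun hd => ?_, ?_⟩
  · rw [eq_C_of_natDegree_eq_zero (derivative_eq_zero.1 hd), eval_C] at ha hPt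
    exact hPt ha
  · obtain ⟨c, ⟨hac, hcb⟩, hc⟩ := exists_hasDerivAt_eq_zero (hat.trans htb)
      P.continuous.continuousOn (ha.trans hb.symm) fun x _ => P.hasDerivAt x
    refine ⟨c, hc, fun i hi => eval_pos_of_no_root (fun y hy => hroot (hno y ?_ ?_) i hi) (ht i hi)⟩
    · exact (lt_min hat hac).trans_le hy.1
    · exact hy.2.trans_lt (max_lt htb hcb)

end Polynomial

/-! ### Elimination of one variable -/

namespace IsSemialgebraic

theorem specialize_eq_zero (P : (MvPolynomial ι ℝ)[X]) :
    IsSemialgebraic {x : ι → ℝ | P.specialize x = 0} := by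
  convert biInter P.support.finite_toSet fun i _ => eq_zero (P.coeff i) using 1
  ext x
  simp only [Set.mem_ofPred_eq, Set.mem_iInter, Polynomial.ext_iff, coeff_map, coeff_zero]
  refine ⟨fun h i _ => h i, fun h i => ?_⟩
  by_cases hi : i ∈ P.support
  · exact h i hi
  · rw [notMem_support_iff.1 hi, map_zero]

/-- Nonvanishing is required because the root multiset of the zero polynomial is empty, so that the
Tarski queries would count nothing. -/
theorem specialize_ne_zero_and_exists_root (P : (MvPolynomial ι ℝ)[X]) (s : Finset κ)
    (G : κ → (MvPolynomial ι ℝ)[X]) : IsSemialgebraic {x : ι → ℝ | P.specialize x ≠ 0 ∧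
      ∃ t, (P.specialize x).eval t = 0 ∧ ∀ i ∈ s, 0 < ((G i).specialize x).eval t} := by
  classical
  have h := (IsSemialgebraicStep.sum s.powerset fun S _ => IsSemialgebraicStep.cauchyIndex
    (derivative P * ((∏ i ∈ S, G i ^ 2) * ∏ i ∈ s \ S, G i)) P).2 {0}ᶜ
  convert (specialize_eq_zero P).compl.inter h using 1
  ext x
  refine and_congr_right fun hx => ?_
  rw [exists_root_forall_pos_iff _ hx]
  simp only [specialize, Polynomial.map_mul, Polynomial.map_prod, Polynomial.map_pow,
    derivative_map, Set.mem_preimage, Set.mem_compl_iff, Set.mem_singleton_iff, Ne]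

theorem _root_.Polynomial.specialize_derivative_prod (s : Finset κ)
    (G : κ → (MvPolynomial ι ℝ)[X]) (x : ι → ℝ) :
    derivative (∏ i ∈ s, (G i).specialize x) = (derivative (∏ i ∈ s, G i)).specialize x := by
  rw [specialize, ← derivative_map, Polynomial.map_prod]

theorem exists_forall_pos (s : Finset κ) (G : κ → (MvPolynomial ι ℝ)[X]) :
    IsSemialgebraic {x : ι → ℝ | ∃ t, ∀ i ∈ s, 0 < ((G i).specialize x).eval t} := by
  have h₁ : IsSemialgebraic {x : ι → ℝ | ∀ i ∈ s, 0 < ((G i).specialize x).leadingCoeff} := by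
    convert biInter s.finite_toSet fun i _ =>
      (IsSemialgebraicStep.of_lead (fun _ σ => if σ = 1 then 1 else 0) (G i)).2 {1} using 1
    ext x
    simp [sign_eq_one_iff]
  have h₂ : IsSemialgebraic {x : ι → ℝ | ∀ i ∈ s,
      0 < (-1) ^ ((G i).specialize x).natDegree * ((G i).specialize x).leadingCoeff} := by
    convert biInter s.finite_toSet fun i _ =>
      (IsSemialgebraicStep.of_lead (fun n σ => if (-1) ^ n * σ = 1 then 1 else 0) (G i)).2 {1}
      using 1
    ext x
    have : ∀ (n : ℕ) (a : ℝ), 0 < (-1) ^ n * a ↔ (-1) ^ n * SignType.sign a = 1 := by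
      intro n a
      rw [← sign_eq_one_iff, sign_mul, sign_pow, Left.sign_neg, sign_one]
    simp [this]
  convert h₁.union (h₂.union (specialize_ne_zero_and_exists_root (derivative (∏ i ∈ s, G i)) s G))
    using 1
  ext x
  rw [Set.mem_ofPred_eq, exists_forall_pos_iff, specialize_derivative_prod]
  rfl

theorem exists_root_forall_pos (P : (MvPolynomial ι ℝ)[X]) (s : Finset κ)
    (G : κ → (MvPolynomial ι ℝ)[X]) : IsSemialgebraic {x : ι → ℝ |
      ∃ t, (P.specialize x).eval t = 0 ∧ ∀ i ∈ s, 0 < ((G i).specialize x).eval t} := by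
  convert (specialize_ne_zero_and_exists_root P s G).union
    ((specialize_eq_zero P).inter (exists_forall_pos s G)) using 1
  ext x
  by_cases hx : P.specialize x = 0 <;> simp [hx]

/-- The **Tarski–Seidenberg theorem**: projections of semialgebraic sets are semialgebraic. -/
theorem exists_option_elim {S : Set (Option ι → ℝ)} (hS : IsSemialgebraic S) :
    IsSemialgebraic {x : ι → ℝ | ∃ t : ℝ, (fun o => Option.elim o t x) ∈ S} := by
  classical
  obtain ⟨s, hs⟩ := hS.exists_finset_sign
  -- The sign vectors realized in `S`. There are finitely many, and `S` is the union of the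
  -- corresponding sign cells.
  let A : Set (s → SignType) := {σ | ∃ z ∈ S, ∀ p, SignType.sign (p.1.eval z) = σ p}
  have hA : {x : ι → ℝ | ∃ t : ℝ, (fun o => Option.elim o t x) ∈ S} = ⋃ σ ∈ A, {x : ι → ℝ | ∃ t : ℝ,
      ∀ p : s, SignType.sign (p.1.eval fun o => Option.elim o t x) = σ p} := by
    ext x
    simp only [Set.mem_ofPred_eq, Set.mem_iUnion, A]
    constructor
    · rintro ⟨t, ht⟩
      exact ⟨_, ⟨_, ht, fun p => rfl⟩, t, fun p => rfl⟩
    · rintro ⟨σ, ⟨z, hz, hσ⟩, t, ht⟩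
      exact ⟨t, (hs _ z fun p hp => (ht ⟨p, hp⟩).trans (hσ ⟨p, hp⟩).symm).2 hz⟩
  rw [hA]
  refine biUnion (Set.toFinite A) fun σ _ => ?_
  let Q : s → (MvPolynomial ι ℝ)[X] := fun p => MvPolynomial.optionEquivLeft ℝ ι p.1
  -- The equations of a cell merge into the vanishing of one sum of squares; multiplying by the
  -- prescribed sign turns the remaining conditions into positivity.
  convert exists_root_forall_pos (∑ p with σ p = 0, Q p ^ 2) (Finset.univ.filter (σ · ≠ 0))
    (fun p => (σ p : (MvPolynomial ι ℝ)[X]) * Q p) using 1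
  ext x
  refine exists_congr fun t => ?_
  have hQ : ∀ p : s, p.1.eval (fun o => Option.elim o t x) = ((Q p).specialize x).eval t :=
    fun p => MvPolynomial.optionEquivLeft_elim_eval ℝ ι x t p.1
  have hsum : ((∑ p with σ p = 0, Q p ^ 2).specialize x).eval t =
      ∑ p with σ p = 0, ((Q p).specialize x).eval t ^ 2 := by
    simp [specialize, Polynomial.map_sum, eval_finsetSum]
  rw [hsum, Finset.sum_eq_zero_iff_of_nonneg fun _ _ => sq_nonneg _]
  simp only [hQ, Finset.mem_filter, Finset.mem_univ, true_and, sq_eq_zero_iff, ← forall_and]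
  refine forall_congr' fun p => ?_
  have hmul : (((σ p : (MvPolynomial ι ℝ)[X]) * Q p).specialize x).eval t =
      (σ p : ℝ) * ((Q p).specialize x).eval t := by
    cases σ p <;> simp [specialize]
  rw [hmul]
  cases h : σ p <;> simp [sign_eq_one_iff, sign_eq_neg_one_iff, sign_eq_zero_iff]

end IsSemialgebraic

end Projection

/-! ### First-order definable sets and semialgebraic functions -/

namespace IsSemialgebraic

variable {ι κ : Type*}

theorem and {P Q : (ι → ℝ) → Prop} (hP : IsSemialgebraic {x | P x})
    (hQ : IsSemialgebraic {x | Q x}) : IsSemialgebraic {x | P x ∧ Q x} := hP.inter hQ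

theorem or {P Q : (ι → ℝ) → Prop} (hP : IsSemialgebraic {x | P x})
    (hQ : IsSemialgebraic {x | Q x}) : IsSemialgebraic {x | P x ∨ Q x} := hP.union hQ

theorem not {P : (ι → ℝ) → Prop} (hP : IsSemialgebraic {x | P x}) :
    IsSemialgebraic {x | ¬ P x} := hP.compl

theorem imp {P Q : (ι → ℝ) → Prop} (hP : IsSemialgebraic {x | P x})
    (hQ : IsSemialgebraic {x | Q x}) : IsSemialgebraic {x | P x → Q x} := by
  simpa only [imp_iff_not_or] using hP.not.or hQ

theorem iff {P Q : (ι → ℝ) → Prop} (hP : IsSemialgebraic {x | P x})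
    (hQ : IsSemialgebraic {x | Q x}) : IsSemialgebraic {x | P x ↔ Q x} := by
  simpa only [iff_iff_implies_and_implies] using (hP.imp hQ).and (hQ.imp hP)

theorem exists_finite [Finite κ] {P : κ → (ι → ℝ) → Prop} (hP : ∀ k, IsSemialgebraic {x | P k x}) :
    IsSemialgebraic {x | ∃ k, P k x} := by
  simpa only [Set.ofPred_exists] using iUnion hP

theorem forall_finite [Finite κ] {P : κ → (ι → ℝ) → Prop} (hP : ∀ k, IsSemialgebraic {x | P k x}) :
    IsSemialgebraic {x | ∀ k, P k x} := by
  simpa only [Set.ofPred_forall] using iInter hP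

/-- A condition that depends only on the truth values of finitely many semialgebraic conditions
is semialgebraic. -/
theorem of_forall_iff [Finite κ] {R : κ → (ι → ℝ) → Prop} (hR : ∀ k, IsSemialgebraic {x | R k x})
    (Q : (κ → Prop) → Prop) : IsSemialgebraic {x | Q fun k => R k x} := by
  have : IsSemialgebraic {x | ∃ s : {s : κ → Prop // Q s}, ∀ k, R k x ↔ s.1 k} :=
    exists_finite fun s => forall_finite fun k => (hR k).iff (const _)
  convert this using 3 with x
  constructor
  · exact fun h => ⟨⟨_, h⟩, fun k => Iff.rfl⟩
  · rintro ⟨⟨s, hs⟩, h⟩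
    rwa [show (fun k => R k x) = s from funext fun k => propext (h k)]

/-- Preimages of semialgebraic sets under polynomial maps are semialgebraic. -/
theorem preimage_eval {S : Set (κ → ℝ)} (hS : IsSemialgebraic S) (φ : κ → MvPolynomial ι ℝ) :
    IsSemialgebraic {x : ι → ℝ | (fun k => (φ k).eval x) ∈ S} := by
  have hφ : ∀ (f : MvPolynomial κ ℝ) (x : ι → ℝ),
      f.eval (fun k => (φ k).eval x) = (MvPolynomial.bind₁ φ f).eval x := fun f x => by
    rw [← MvPolynomial.coe_aeval_eq_eval, ← MvPolynomial.coe_aeval_eq_eval]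
    exact (MvPolynomial.aeval_bind₁ _ _ _).symm
  induction hS with
  | eq_zero f =>
    simp only [Set.mem_ofPred_eq, hφ]
    exact eq_zero _
  | lt_zero f =>
    simp only [Set.mem_ofPred_eq, hφ]
    exact lt_zero _
  | compl _ ih => exact ih.compl
  | union _ _ ih₁ ih₂ => exact ih₁.union ih₂
  | inter _ _ ih₁ ih₂ => exact ih₁.inter ih₂

theorem reindex {S : Set (κ → ℝ)} (hS : IsSemialgebraic S) (σ : κ → ι) :
    IsSemialgebraic {x : ι → ℝ | (fun k => x (σ k)) ∈ S} := by
  simpa using hS.preimage_eval fun k => MvPolynomial.X (σ k)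

theorem exists_real {P : (ι → ℝ) → ℝ → Prop}
    (hP : IsSemialgebraic {z : Option ι → ℝ | P (fun i => z (some i)) (z none)}) :
    IsSemialgebraic {x | ∃ t, P x t} :=
  hP.exists_option_elim

theorem forall_real {P : (ι → ℝ) → ℝ → Prop}
    (hP : IsSemialgebraic {z : Option ι → ℝ | P (fun i => z (some i)) (z none)}) :
    IsSemialgebraic {x | ∀ t, P x t} := by
  simpa only [not_exists, not_not] using (exists_real (P := fun x t => ¬ P x t) hP.not).not

theorem exists_sum_elim [Finite κ] {S : Set (ι ⊕ κ → ℝ)} (hS : IsSemialgebraic S) :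
    IsSemialgebraic {x : ι → ℝ | ∃ y : κ → ℝ, Sum.elim x y ∈ S} := by
  induction κ using Finite.induction_empty_option with
  | of_equiv e ih =>
    convert ih (hS.reindex (Sum.map id e.symm)) using 3 with x
    refine ⟨fun ⟨y, hy⟩ => ⟨y ∘ e, ?_⟩, fun ⟨y, hy⟩ => ⟨y ∘ e.symm, ?_⟩⟩
    · simp only [Set.mem_ofPred_eq]
      convert hy using 1
      ext (i | k) <;> simp
    · simp only [Set.mem_ofPred_eq] at hy
      convert hy using 1
      ext (i | k) <;> simp
  | h_empty =>
    convert hS.reindex (Sum.elim id PEmpty.elim) using 3 with x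
    refine ⟨fun ⟨y, hy⟩ => ?_, fun hx => ⟨PEmpty.elim, ?_⟩⟩
    · convert hy using 1
      ext (i | k)
      · simp
      · exact k.elim
    · convert hx using 1
      ext (i | k)
      · simp
      · exact k.elim
  | h_option ih =>
    rename_i κ _
    convert ih (exists_option_elim (hS.reindex (ι := Option (ι ⊕ κ))
      (Sum.elim (fun i => some (Sum.inl i)) fun o => o.elim none fun k => some (Sum.inr k)))) using 3
      with x
    refine ⟨fun ⟨y, hy⟩ => ⟨fun k => y (some k), y none, ?_⟩,
      fun ⟨y, t, hy⟩ => ⟨fun o => o.elim t y, ?_⟩⟩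
    · simp only [Set.mem_ofPred_eq]
      convert hy using 1
      ext (i | _ | k) <;> simp
    · simp only [Set.mem_ofPred_eq] at hy
      convert hy using 1
      ext (i | _ | k) <;> simp

theorem exists_pi [Finite κ] {P : (ι → ℝ) → (κ → ℝ) → Prop}
    (hP : IsSemialgebraic {z : ι ⊕ κ → ℝ | P (fun i => z (Sum.inl i)) fun k => z (Sum.inr k)}) :
    IsSemialgebraic {x | ∃ y, P x y} :=
  hP.exists_sum_elim

end IsSemialgebraic

/-- Real functions with semialgebraic graph. -/
def IsSemialgebraicFun {ι : Type*} (f : (ι → ℝ) → ℝ) : Prop :=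
  IsSemialgebraic {z : Option ι → ℝ | z none = f fun i => z (some i)}

namespace IsSemialgebraicFun

variable {ι κ : Type*} {f g : (ι → ℝ) → ℝ}

theorem reindex (hf : IsSemialgebraicFun f) (σ : ι → κ) :
    IsSemialgebraicFun fun x : κ → ℝ => f fun i => x (σ i) := by
  exact IsSemialgebraic.reindex hf (Option.map σ)

theorem graph_reindex (hf : IsSemialgebraicFun f) (k : κ) (σ : ι → κ) :
    IsSemialgebraic {x : κ → ℝ | x k = f fun i => x (σ i)} := by
  exact IsSemialgebraic.reindex hf fun o => o.elim k σ

theorem of_poly (p : MvPolynomial ι ℝ) : IsSemialgebraicFun fun x => p.eval x := by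
  have := IsSemialgebraic.eq_zero (.X none - MvPolynomial.rename some p)
  unfold IsSemialgebraicFun
  simpa [MvPolynomial.eval_rename, sub_eq_zero, Function.comp_def] using this

theorem of_coord (i : ι) : IsSemialgebraicFun fun x => x i := by
  simpa using of_poly (MvPolynomial.X i)

theorem const (c : ℝ) : IsSemialgebraicFun fun _ : ι → ℝ => c := by
  simpa using of_poly (MvPolynomial.C (σ := ι) c)

/-- The values `f k x` are named by new variables constrained to the graphs, and these variables are
then projected away. -/
theorem mem [Finite κ] {S : Set (κ → ℝ)} (hS : IsSemialgebraic S) {f : κ → (ι → ℝ) → ℝ}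
    (hf : ∀ k, IsSemialgebraicFun (f k)) : IsSemialgebraic {x | (fun k => f k x) ∈ S} := by
  have : IsSemialgebraic {x : ι → ℝ | ∃ y : κ → ℝ, (∀ k, y k = f k x) ∧ y ∈ S} := by
    refine IsSemialgebraic.exists_pi (IsSemialgebraic.and
      (IsSemialgebraic.forall_finite fun k => ?_) (hS.reindex Sum.inr))
    exact (hf k).graph_reindex (Sum.inr k) Sum.inl
  convert this using 3 with x
  refine ⟨fun h => ⟨_, fun _ => rfl, h⟩, fun ⟨y, hy, h⟩ => ?_⟩
  rwa [← show y = fun k => f k x from funext hy]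

theorem comp [Finite κ] {F : (κ → ℝ) → ℝ} (hF : IsSemialgebraicFun F) {f : κ → (ι → ℝ) → ℝ}
    (hf : ∀ k, IsSemialgebraicFun (f k)) : IsSemialgebraicFun fun x => F fun k => f k x := by
  have := mem (ι := Option ι) hF (f := fun o z => o.elim (z none) fun k => f k fun i => z (some i))
    (fun o => ?_)
  · exact this
  · cases o with
    | none => exact of_coord _
    | some k => exact (hf k).reindex some

theorem add (hf : IsSemialgebraicFun f) (hg : IsSemialgebraicFun g) :
    IsSemialgebraicFun fun x => f x + g x := by
  simpa using comp (of_poly (.X 0 + .X 1 : MvPolynomial (Fin 2) ℝ)) (f := ![f, g])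
    (Fin.forall_fin_two.2 ⟨hf, hg⟩)

theorem mul (hf : IsSemialgebraicFun f) (hg : IsSemialgebraicFun g) :
    IsSemialgebraicFun fun x => f x * g x := by
  simpa using comp (of_poly (.X 0 * .X 1 : MvPolynomial (Fin 2) ℝ)) (f := ![f, g])
    (Fin.forall_fin_two.2 ⟨hf, hg⟩)

theorem sub (hf : IsSemialgebraicFun f) (hg : IsSemialgebraicFun g) :
    IsSemialgebraicFun fun x => f x - g x := by
  simpa using comp (of_poly (.X 0 - .X 1 : MvPolynomial (Fin 2) ℝ)) (f := ![f, g])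
    (Fin.forall_fin_two.2 ⟨hf, hg⟩)

theorem neg (hf : IsSemialgebraicFun f) : IsSemialgebraicFun fun x => - f x := by
  simpa using (const 0).sub hf

theorem _root_.IsSemialgebraic.setOf_eq (hf : IsSemialgebraicFun f) (hg : IsSemialgebraicFun g) :
    IsSemialgebraic {x | f x = g x} := by
  simpa [sub_eq_zero] using mem (IsSemialgebraic.eq_zero (.X 0 - .X 1 : MvPolynomial (Fin 2) ℝ))
    (f := ![f, g]) (Fin.forall_fin_two.2 ⟨hf, hg⟩)

theorem _root_.IsSemialgebraic.setOf_lt (hf : IsSemialgebraicFun f) (hg : IsSemialgebraicFun g) :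
    IsSemialgebraic {x | f x < g x} := by
  simpa [sub_neg] using mem (IsSemialgebraic.lt_zero (.X 0 - .X 1 : MvPolynomial (Fin 2) ℝ))
    (f := ![f, g]) (Fin.forall_fin_two.2 ⟨hf, hg⟩)

theorem _root_.IsSemialgebraic.setOf_le (hf : IsSemialgebraicFun f) (hg : IsSemialgebraicFun g) :
    IsSemialgebraic {x | f x ≤ g x} := by
  simpa only [not_lt] using IsSemialgebraic.not (.setOf_lt hg hf)

theorem inv (hf : IsSemialgebraicFun f) : IsSemialgebraicFun fun x => (f x)⁻¹ := by
  have hx := hf.reindex (some : ι → Option ι)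
  have hy : IsSemialgebraicFun fun z : Option ι → ℝ => z none := of_coord none
  -- The first alternative is the convention that the inverse of 0 is 0.
  have := IsSemialgebraic.or (.and (.setOf_eq hx (const 0)) (.setOf_eq hy (const 0)))
    (.and (.not (.setOf_eq hx (const 0))) (.setOf_eq (hx.mul hy) (const 1)))
  unfold IsSemialgebraicFun
  convert this using 3 with z
  by_cases h : f (fun i => z (some i)) = 0
  · simp [h]
  · simp only [h, false_and, false_or, not_false_eq_true, true_and]
    exact ⟨fun h' => by rw [h', mul_inv_cancel₀ h], eq_inv_of_mul_eq_one_right⟩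

theorem sqrt (hf : IsSemialgebraicFun f) : IsSemialgebraicFun fun x => √(f x) := by
  have hx := hf.reindex (some : ι → Option ι)
  have hy : IsSemialgebraicFun fun z : Option ι → ℝ => z none := of_coord none
  -- The first alternative is the convention that the root of a negative number is 0.
  have := IsSemialgebraic.or (.and (.setOf_lt hx (const 0)) (.setOf_eq hy (const 0)))
    (.and (.not (.setOf_lt hx (const 0))) (.and (.setOf_le (const 0) hy) (.setOf_eq (hy.mul hy) hx)))
  unfold IsSemialgebraicFun
  convert this using 3 with z
  rcases lt_or_ge (f fun i => z (some i)) 0 with h | h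
  · simp [h, Real.sqrt_eq_zero_of_nonpos h.le]
  · rw [eq_comm]
    constructor
    · rintro h'
      rw [← h']
      exact Or.inr ⟨h.not_gt, Real.sqrt_nonneg _, Real.mul_self_sqrt h⟩
    · rintro (⟨h', -⟩ | ⟨-, h0, h'⟩)
      · exact absurd h' h.not_gt
      · beta_reduce
        rw [← h', Real.sqrt_mul_self h0]

theorem abs (hf : IsSemialgebraicFun f) : IsSemialgebraicFun fun x => |f x| := by
  simpa only [← Real.sqrt_mul_self_eq_abs] using (hf.mul hf).sqrt

/-- A family of bounded intervals that is semialgebraic has semialgebraic lengths. -/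
theorem volume_real [Finite ι] {S : (ι → ℝ) → Set ℝ}
    (hS : IsSemialgebraic {z : Option ι → ℝ | z none ∈ S fun i => z (some i)})
    (hconv : ∀ x, (S x).OrdConnected) (hb : ∀ x, Bornology.IsBounded (S x)) :
    IsSemialgebraicFun fun x => (volume : Measure ℝ).real (S x) := by
  -- The measure is replaced by a first-order condition: the set lies between the open and the
  -- closed interval with endpoints `a` and `b`, and `r` is their difference. An empty set is
  -- covered by `a = b`.
  have key : ∀ x r, r = (volume : Measure ℝ).real (S x) ↔ ∃ a b, a ≤ b ∧
      (∀ t, a < t ∧ t < b → t ∈ S x) ∧ (∀ t, t ∈ S x → a ≤ t ∧ t ≤ b) ∧ r = b - a := by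
    intro x r
    have hvol : ∀ a b, a ≤ b → Set.Ioo a b ⊆ S x → S x ⊆ Set.Icc a b →
        (volume : Measure ℝ).real (S x) = b - a := by
      intro a b hab h₁ h₂
      refine le_antisymm ?_ ?_
      · rw [← Real.volume_real_Icc_of_le hab]
        exact measureReal_mono h₂ measure_Icc_lt_top.ne
      · rw [← Real.volume_real_Ioo_of_le hab]
        exact measureReal_mono h₁ (hb x).measure_lt_top.ne
    constructor
    · rintro rfl
      rcases (S x).eq_empty_or_nonempty with he | hne
      · exact ⟨0, 0, le_rfl, fun t ht => absurd (ht.1.trans ht.2) (lt_irrefl _), by simp [he],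
          by simp [he]⟩
      · have hA := (hb x).bddAbove
        have hB := (hb x).bddBelow
        have hab : sInf (S x) ≤ sSup (S x) := csInf_le_csSup hne hB hA
        have h₁ : Set.Ioo (sInf (S x)) (sSup (S x)) ⊆ S x := by
          rintro t ⟨ht₁, ht₂⟩
          obtain ⟨u, hu, hut⟩ := exists_lt_of_csInf_lt hne ht₁
          obtain ⟨v, hv, htv⟩ := exists_lt_of_lt_csSup hne ht₂
          exact (hconv x).out hu hv ⟨hut.le, htv.le⟩
        have h₂ : S x ⊆ Set.Icc (sInf (S x)) (sSup (S x)) :=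
          fun t ht => ⟨csInf_le hB ht, le_csSup hA ht⟩
        exact ⟨_, _, hab, h₁, h₂, hvol _ _ hab h₁ h₂⟩
    · rintro ⟨a, b, hab, h₁, h₂, rfl⟩
      exact (hvol a b hab h₁ h₂).symm
  unfold IsSemialgebraicFun
  simp only [key]
  -- The variables, from the innermost `none` outwards in binding order, are `t`, `b`, `a`, `r` and
  -- then the coordinates of `x`.
  have hmem : IsSemialgebraic {z : Option (Option (Option (Option ι))) → ℝ |
      z none ∈ S fun i => z (some (some (some (some i))))} := by
    exact hS.reindex fun o => o.elim none fun i => some (some (some (some i)))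
  refine .exists_real (.exists_real (.and (.setOf_le (of_coord _) (of_coord _))
    (.and (.forall_real (.imp (.and (.setOf_lt (of_coord _) (of_coord _))
      (.setOf_lt (of_coord _) (of_coord _))) hmem))
    (.and (.forall_real (.imp hmem (.and (.setOf_le (of_coord _) (of_coord _))
      (.setOf_le (of_coord _) (of_coord _)))))
    (.setOf_eq (of_coord _) ((of_coord _).sub (of_coord _)))))))

end IsSemialgebraicFun

/-! ### Semialgebraic plane geometry -/

/-- Plane-valued functions with semialgebraic coordinates. -/
def IsSemialgebraicPlane {ι : Type*} (f : (ι → ℝ) → Plane) : Prop :=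
  ∀ i, IsSemialgebraicFun fun x => f x i

namespace IsSemialgebraicPlane

variable {ι κ : Type*} {a b c d : (ι → ℝ) → Plane}

theorem reindex (ha : IsSemialgebraicPlane a) (σ : ι → κ) :
    IsSemialgebraicPlane fun x : κ → ℝ => a fun i => x (σ i) := fun i => (ha i).reindex σ

theorem mk {f g : (ι → ℝ) → ℝ} (hf : IsSemialgebraicFun f) (hg : IsSemialgebraicFun g) :
    IsSemialgebraicPlane fun x => !₂[f x, g x] :=
  Fin.forall_fin_two.2 ⟨hf, hg⟩

theorem add (ha : IsSemialgebraicPlane a) (hb : IsSemialgebraicPlane b) :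
    IsSemialgebraicPlane fun x => a x + b x := fun i => (ha i).add (hb i)

theorem sub (ha : IsSemialgebraicPlane a) (hb : IsSemialgebraicPlane b) :
    IsSemialgebraicPlane fun x => a x - b x := fun i => (ha i).sub (hb i)

theorem smul {f : (ι → ℝ) → ℝ} (hf : IsSemialgebraicFun f) (ha : IsSemialgebraicPlane a) :
    IsSemialgebraicPlane fun x => f x • a x := fun i => hf.mul (ha i)

theorem rotateLeft (ha : IsSemialgebraicPlane a) :
    IsSemialgebraicPlane fun x => _root_.rotateLeft (a x) := mk (ha 1).neg (ha 0)

theorem dist (ha : IsSemialgebraicPlane a) (hb : IsSemialgebraicPlane b) :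
    IsSemialgebraicFun fun x => Dist.dist (a x) (b x) := by
  have h : ∀ i, IsSemialgebraicFun fun x => Dist.dist (a x i) (b x i) ^ 2 := fun i => by
    simpa only [Real.dist_eq, sq_abs, ← sq] using ((ha i).sub (hb i)).mul ((ha i).sub (hb i))
  simpa only [EuclideanSpace.dist_eq, Fin.sum_univ_two] using ((h 0).add (h 1)).sqrt

theorem setOf_eq (ha : IsSemialgebraicPlane a) (hb : IsSemialgebraicPlane b) :
    IsSemialgebraic {x | a x = b x} := by
  have : ∀ x, a x = b x ↔ ∀ i, a x i = b x i := fun x => PiLp.ext_iff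
  simp only [this]
  exact .forall_finite fun i => .setOf_eq (ha i) (hb i)

theorem mem_segment (ha : IsSemialgebraicPlane a) (hb : IsSemialgebraicPlane b)
    (hc : IsSemialgebraicPlane c) : IsSemialgebraic {x | a x ∈ segment ℝ (b x) (c x)} := by
  have : ∀ x, a x ∈ segment ℝ (b x) (c x) ↔ ∃ t : ℝ, (0 ≤ t ∧ t ≤ 1) ∧
      b x + t • (c x - b x) = a x := fun x => by
    rw [segment_eq_image']
    rfl
  simp only [this]
  refine .exists_real (.and (.and (.setOf_le (.const 0) (.of_coord _))
    (.setOf_le (.of_coord _) (.const 1))) ?_)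
  exact IsSemialgebraicPlane.setOf_eq ((hb.reindex _).add (smul (.of_coord _) ((hc.reindex _).sub (hb.reindex _))))
    (ha.reindex _)

theorem _root_.IsSemialgebraic.forall_plane {P : (ι → ℝ) → Plane → Prop}
    (hP : IsSemialgebraic {z : Option (Option ι) → ℝ |
      P (fun i => z (some (some i))) !₂[z (some none), z none]}) :
    IsSemialgebraic {x | ∀ p, P x p} := by
  have : ∀ x, (∀ p, P x p) ↔ ∀ s t, P x !₂[s, t] := fun x => by
    refine ⟨fun h s t => h _, fun h p => ?_⟩
    have hp : p = !₂[p 0, p 1] := by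
      ext i
      fin_cases i <;> rfl
    rw [hp]
    exact h _ _
  simp only [this]
  exact .forall_real (.forall_real hP)

theorem framePoint (ha : IsSemialgebraicPlane a) (hb : IsSemialgebraicPlane b)
    {f g : (ι → ℝ) → ℝ} (hf : IsSemialgebraicFun f) (hg : IsSemialgebraicFun g) :
    IsSemialgebraicPlane fun x => PlaneEdge.framePoint (a x, b x) (f x) (g x) := by
  have hd : IsSemialgebraicPlane fun x => PlaneEdge.direction (a x, b x) :=
    smul (ha.dist hb).inv (hb.sub ha)
  exact (ha.add (smul hf hd)).add (smul hg hd.rotateLeft)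

end IsSemialgebraicPlane

/-- The part of `e₂` whose second frame coordinate lies in a convex set projects to an interval. -/
theorem PlaneEdge.ordConnected_shadow (e₁ e₂ : PlaneEdge) {I : Set ℝ} (hI : Convex ℝ I) :
    {x | x ∈ Set.Icc 0 e₁.length ∧ ∃ y, y ∈ I ∧ e₁.framePoint x y ∈ e₂.carrier}.OrdConnected := by
  -- The frame map is affine in (x, y), even for a degenerate `e₁`, so the shadow is the projection
  -- to the first coordinate of a convex set.
  refine Convex.ordConnected ?_
  rintro x₁ ⟨hx₁, y₁, hy₁, h₁⟩ x₂ ⟨hx₂, y₂, hy₂, h₂⟩ s t hs ht hst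
  refine ⟨convex_Icc _ _ hx₁ hx₂ hs ht hst, s • y₁ + t • y₂, hI hy₁ hy₂ hs ht hst, ?_⟩
  have hcarrier : Convex ℝ e₂.carrier := convex_segment _ _
  convert hcarrier h₁ h₂ hs ht hst using 1
  obtain rfl : t = 1 - s := by linarith
  simp only [framePoint, smul_eq_mul]
  module

namespace IsSemialgebraicPlane

variable {ι κ : Type*} {a b c d : (ι → ℝ) → Plane}

/-- Taking for `I` the closed upper or lower half-line gives `dPlus` or `dMinus`. -/
theorem volume_shadow [Finite ι] (ha : IsSemialgebraicPlane a) (hb : IsSemialgebraicPlane b)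
    (hc : IsSemialgebraicPlane c) (hd : IsSemialgebraicPlane d) {I : Set ℝ} (hI : Convex ℝ I)
    (hI' : IsSemialgebraic {z : Option (Option ι) → ℝ | z none ∈ I}) :
    IsSemialgebraicFun fun x => (volume : Measure ℝ).real {t | t ∈ Set.Icc 0
      (PlaneEdge.length (a x, b x)) ∧ ∃ y, y ∈ I ∧
        PlaneEdge.framePoint (a x, b x) t y ∈ PlaneEdge.carrier (c x, d x)} := by
  refine .volume_real ?_ (fun x => PlaneEdge.ordConnected_shadow _ _ hI)
    fun x => (Metric.isBounded_Icc _ _).subset fun t ht => ht.1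
  refine .and (.and (.setOf_le (.const 0) (.of_coord _))
    (.setOf_le (.of_coord _) ((ha.reindex _).dist (hb.reindex _)))) (.exists_real (.and hI' ?_))
  exact mem_segment (framePoint (ha.reindex _) (hb.reindex _) (.of_coord _) (.of_coord _))
    (hc.reindex _) (hd.reindex _)

theorem ord [Finite ι] (ha : IsSemialgebraicPlane a) (hb : IsSemialgebraicPlane b)
    (hc : IsSemialgebraicPlane c) (hd : IsSemialgebraicPlane d) :
    IsSemialgebraicFun fun x => PlaneEdge.ord (a x, b x) (c x, d x) :=
  (volume_shadow ha hb hc hd (convex_Ici 0) (.setOf_le (.const 0) (.of_coord _))).sub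
    (volume_shadow ha hb hc hd (convex_Iic 0) (.setOf_le (.of_coord _) (.const 0)))

end IsSemialgebraicPlane

/-! ### Configuration spaces -/

/-- The linkage whose bar lengths are those realized by a placement. -/
noncomputable def OrientedGraph.inducedLinkage {V E : Type*} (G : OrientedGraph V E)
    (C : V → Plane) : Linkage V E :=
  ⟨G, fun e => nndist (C (G.src e)) (C (G.tgt e))⟩

/-- The bar length realized by a placement. -/
noncomputable def OrientedGraph.barDist {V E : Type*} (G : OrientedGraph V E) (C : V → Plane)
    (e : E) : ℝ :=
  dist (C (G.src e)) (C (G.tgt e))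

namespace Linkage

variable {V E : Type*}

theorem eq_inducedLinkage {L : Linkage V E} {C : V → Plane} (hC : C ∈ L.Conf) :
    L = L.graph.inducedLinkage C := by
  obtain ⟨G, l⟩ := L
  have : l = fun e => nndist (C (G.src e)) (C (G.tgt e)) := funext fun e => NNReal.eq (hC e).symm
  rw [this]
  rfl

/-- Graph and placement determine the lengths, so the only candidate for `L'` is the induced linkage
and no quantifier over linkages remains. -/
theorem exists_related_iff {ε : ℝ} {L : Linkage V E} {C : V → Plane} {P : Linkage V E → Prop}
    (hP : ∀ L', P L' → C ∈ L'.Conf) : (∃ L', Related ε L L' ∧ P L') ↔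
      (∀ e, |(L.len e : ℝ) - L.graph.barDist C e| ≤ ε) ∧ P (L.graph.inducedLinkage C) := by
  constructor
  · rintro ⟨L', ⟨hG, hl⟩, h⟩
    obtain rfl : L' = L.graph.inducedLinkage C := hG ▸ eq_inducedLinkage (hP L' h)
    exact ⟨hl, h⟩
  · rintro ⟨hl, h⟩
    exact ⟨L.graph.inducedLinkage C, ⟨rfl, hl⟩, h⟩

theorem mem_confRel_iff {ε : ℝ} {L : Linkage V E} {C : V → Plane} :
    C ∈ L.ConfRel ε ↔ ∀ e, |(L.len e : ℝ) - L.graph.barDist C e| ≤ ε :=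
  (exists_related_iff fun _ h => h).trans (and_iff_left fun _ => rfl)

theorem mem_nconfRel_iff {ε : ℝ} {L : Linkage V E} {C : V → Plane} :
    C ∈ L.NConfRel ε ↔ (∀ e, |(L.len e : ℝ) - L.graph.barDist C e| ≤ ε) ∧
      C ∈ (L.graph.inducedLinkage C).NConf :=
  exists_related_iff fun _ h => h.1

theorem mem_noncrossingConfRel_iff {ε : ℝ} {L : Linkage V E} {p : AnnotatedPlacement V E} :
    p ∈ L.NoncrossingConfRel ε ↔ (∀ e, |(L.len e : ℝ) - L.graph.barDist p.1 e| ≤ ε) ∧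
      p ∈ closure ((L.graph.inducedLinkage p.1).AnnNConfRel 1) :=
  (exists_related_iff fun _ h => h.1).trans
    (and_congr_right fun _ => and_iff_right fun _ => rfl)

theorem noncrossingConf_eq (L : Linkage V E) : L.NoncrossingConf = L.NoncrossingConfRel 0 := by
  ext p
  constructor
  · exact fun h => ⟨L, ⟨rfl, by simp⟩, h⟩
  · rintro ⟨⟨G, l'⟩, ⟨hG, hl⟩, h⟩
    obtain ⟨G', l⟩ := L
    obtain rfl : G' = G := hG
    obtain rfl : l' = l := funext fun e => NNReal.eq
      (sub_eq_zero.1 (abs_nonpos_iff.1 (hl e))).symm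
    exact h

end Linkage

/-- The placement with given coordinates. -/
noncomputable def placementOfCoords {V : Type*} (z : V × Fin 2 → ℝ) : V → Plane :=
  fun v => WithLp.toLp 2 fun i => z (v, i)

/-- The annotated placement with given coordinates. -/
noncomputable def annotatedOfCoords {V E : Type*} (z : (V × Fin 2) ⊕ (E × E) → ℝ) :
    AnnotatedPlacement V E :=
  (placementOfCoords fun k => z (Sum.inl k), Matrix.of fun e f => z (Sum.inr (e, f)))

/-! ### Coordinates, closure and the nontouching condition -/

section Coordinates

variable {V E : Type*}

theorem placementCoords_image (S : Set (V → Plane)) :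
    placementCoords '' S = {z | placementOfCoords z ∈ S} :=
  congrFun (Set.image_eq_preimage_of_inverse (g := placementOfCoords) (fun _ => rfl) fun _ => rfl) S

theorem annotatedOfCoords_annotatedCoords (p : AnnotatedPlacement V E) :
    annotatedOfCoords (annotatedCoords p) = p := rfl

theorem annotatedCoords_annotatedOfCoords (z : (V × Fin 2) ⊕ (E × E) → ℝ) :
    annotatedCoords (annotatedOfCoords z) = z := by
  ext (k | k) <;> rfl

theorem annotatedCoords_image (S : Set (AnnotatedPlacement V E)) :
    annotatedCoords '' S = {z | annotatedOfCoords z ∈ S} :=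
  congrFun (Set.image_eq_preimage_of_inverse annotatedOfCoords_annotatedCoords
    annotatedCoords_annotatedOfCoords) S

theorem continuous_annotatedCoords :
    Continuous (annotatedCoords : AnnotatedPlacement V E → _) := by
  refine continuous_pi fun k => ?_
  rcases k with k | k
  · change Continuous fun p : AnnotatedPlacement V E => p.1 k.1 k.2
    fun_prop
  · change Continuous fun p : AnnotatedPlacement V E => p.2 k.1 k.2
    exact (continuous_snd.matrix_elem _ _)

theorem continuous_annotatedOfCoords :
    Continuous (annotatedOfCoords : _ → AnnotatedPlacement V E) := by
  refine Continuous.prodMk ?_ ?_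
  · unfold placementOfCoords
    fun_prop
  · exact continuous_matrix fun e f => continuous_apply _

/-- The coordinate map is an embedding into a finite power of ℝ with the sup distance; this makes
the closure first-order. -/
theorem mem_closure_iff_annotatedCoords [Finite V] [Finite E] {T : Set (AnnotatedPlacement V E)}
    {p : AnnotatedPlacement V E} : p ∈ closure T ↔ ∀ δ : ℝ, 0 < δ → ∃ q ∈ T,
      ∀ k, |annotatedCoords p k - annotatedCoords q k| < δ := by
  cases nonempty_fintype V
  cases nonempty_fintype E
  have hind : Topology.IsInducing (annotatedCoords : AnnotatedPlacement V E → _) :=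
    (Function.LeftInverse.isEmbedding annotatedOfCoords_annotatedCoords
      continuous_annotatedOfCoords continuous_annotatedCoords).isInducing
  rw [hind.closure_eq_preimage_closure_image, Set.mem_preimage, Metric.mem_closure_iff]
  refine forall₂_congr fun δ hδ => ?_
  simp only [Set.exists_mem_image, dist_pi_lt_iff hδ, Real.dist_eq]

variable {ι : Type*} {C : (ι → ℝ) → V → Plane}

theorem IsSemialgebraicFun.barDist (G : OrientedGraph V E)
    (hC : ∀ v, IsSemialgebraicPlane fun x => C x v) (e : E) :
    IsSemialgebraicFun fun x => G.barDist (C x) e := (hC _).dist (hC _)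

theorem OrientedGraph.mem_inducedLinkage_nconf_iff (G : OrientedGraph V E) (C : V → Plane) :
    C ∈ (G.inducedLinkage C).NConf ↔
      (∀ e f, e ≠ f → ∀ p : Plane, p ∈ segment ℝ (C (G.src e)) (C (G.tgt e)) →
        p ∈ segment ℝ (C (G.src f)) (C (G.tgt f)) →
          (∃ u, (u = G.src e ∨ u = G.tgt e) ∧ C u = p) ∧
          (∃ v, (v = G.src f ∨ v = G.tgt f) ∧ C v = p)) ∧
      ∀ u v, (∃ e, u = G.src e ∨ u = G.tgt e) → (∃ f, v = G.src f ∨ v = G.tgt f) →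
        (C u = C v ↔ Relation.ReflTransGen (fun u v => ∃ e, C (G.src e) = C (G.tgt e) ∧
          ((G.src e = u ∧ G.tgt e = v) ∨ (G.src e = v ∧ G.tgt e = u))) u v) := by
  have hadj : (G.inducedLinkage C).ZeroAdj = fun u v => ∃ e, C (G.src e) = C (G.tgt e) ∧
      ((G.src e = u ∧ G.tgt e = v) ∨ (G.src e = v ∧ G.tgt e = u)) := by
    ext u v
    exact exists_congr fun e => and_congr_left fun _ => nndist_eq_zero
  rw [← hadj]
  exact and_iff_right fun _ => rfl

theorem IsSemialgebraic.inducedLinkage_nconf [Finite V] [Finite E] (G : OrientedGraph V E)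
    (hC : ∀ v, IsSemialgebraicPlane fun x => C x v) :
    IsSemialgebraic {x | C x ∈ (G.inducedLinkage (C x)).NConf} := by
  simp only [G.mem_inducedLinkage_nconf_iff]
  have hzero : ∀ e, IsSemialgebraic {x | C x (G.src e) = C x (G.tgt e)} :=
    fun e => (hC _).setOf_eq (hC _)
  -- Paths have no a priori bounded length, but reachability is a function of the finitely many
  -- truth values telling which bars are degenerate.
  have hconn : ∀ u v, IsSemialgebraic {x | Relation.ReflTransGen (fun u v => ∃ e,
      C x (G.src e) = C x (G.tgt e) ∧
        ((G.src e = u ∧ G.tgt e = v) ∨ (G.src e = v ∧ G.tgt e = u))) u v} := fun u v =>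
    .of_forall_iff hzero fun s => Relation.ReflTransGen (fun u v => ∃ e, s e ∧
      ((G.src e = u ∧ G.tgt e = v) ∨ (G.src e = v ∧ G.tgt e = u))) u v
  refine .and (.forall_finite fun e => .forall_finite fun f => .imp (.const _) (.forall_plane ?_))
    (.forall_finite fun u => .forall_finite fun v => .imp (.const _) (.imp (.const _)
      (.iff ((hC u).setOf_eq (hC v)) (hconn u v))))
  have hp : IsSemialgebraicPlane fun z : Option (Option ι) → ℝ => !₂[z (some none), z none] :=
    .mk (.of_coord _) (.of_coord _)
  have hC' : ∀ v, IsSemialgebraicPlane fun z : Option (Option ι) → ℝ =>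
      C (fun i => z (some (some i))) v := fun v => (hC v).reindex _
  have hend : ∀ e, IsSemialgebraic {z : Option (Option ι) → ℝ |
      ∃ u, (u = G.src e ∨ u = G.tgt e) ∧
        C (fun i => z (some (some i))) u = !₂[z (some none), z none]} := fun e =>
    .exists_finite fun u => .and (.const _) ((hC' u).setOf_eq hp)
  exact .imp (hp.mem_segment (hC' _) (hC' _)) (.imp (hp.mem_segment (hC' _) (hC' _))
    (.and (hend e) (hend f)))

theorem isSemialgebraicPlane_placementOfCoords {f : V × Fin 2 → ι} (v : V) :
    IsSemialgebraicPlane fun x : ι → ℝ => placementOfCoords (fun k => x (f k)) v :=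
  fun _ => .of_coord _

end Coordinates

/-! ### Semialgebraicity of the configuration spaces -/

namespace Linkage

variable {V E : Type*}

/-- The map `f` selects the placement coordinates among a possibly larger set of variables, so that
the result also applies to annotated placements. -/
theorem isSemialgebraic_confRel [Finite E] (L : Linkage V E) (ε : ℝ) {ι : Type*} (f : V × Fin 2 → ι) :
    IsSemialgebraic {x : ι → ℝ | placementOfCoords (fun k => x (f k)) ∈ L.ConfRel ε} := by
  simp only [mem_confRel_iff]
  exact .forall_finite fun e => .setOf_le (.abs (.sub (.const _)
    (.barDist _ isSemialgebraicPlane_placementOfCoords e))) (.const _)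

theorem isSemialgebraic_nconfRel [Finite V] [Finite E] (L : Linkage V E) (ε : ℝ) {ι : Type*} (f : V × Fin 2 → ι) :
    IsSemialgebraic {x : ι → ℝ | placementOfCoords (fun k => x (f k)) ∈ L.NConfRel ε} := by
  simp only [mem_nconfRel_iff, ← mem_confRel_iff]
  exact (L.isSemialgebraic_confRel ε f).and
    (.inducedLinkage_nconf _ isSemialgebraicPlane_placementOfCoords)

theorem isSemialgebraicFun_ord (G : OrientedGraph V E) {ι : Type*} [Finite ι] (f : V × Fin 2 → ι)
    (e e' : E) : IsSemialgebraicFun fun x : ι → ℝ =>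
      PlaneEdge.ord (G.edgeImage (placementOfCoords fun k => x (f k)) e)
        (G.edgeImage (placementOfCoords fun k => x (f k)) e') :=
  IsSemialgebraicPlane.ord (isSemialgebraicPlane_placementOfCoords _) (isSemialgebraicPlane_placementOfCoords _)
    (isSemialgebraicPlane_placementOfCoords _) (isSemialgebraicPlane_placementOfCoords _)

/-- The set is the graph, over the nontouching configurations, of a map with semialgebraic
components. -/
theorem isSemialgebraic_annNConfRel [Finite V] [Finite E] (L : Linkage V E) (ε : ℝ) :
    IsSemialgebraic (annotatedCoords '' L.AnnNConfRel ε) := by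
  have : annotatedCoords '' L.AnnNConfRel ε = {z : (V × Fin 2) ⊕ (E × E) → ℝ |
      placementOfCoords (fun k => z (Sum.inl k)) ∈ L.NConfRel ε ∧ ∀ e e', z (Sum.inr (e, e')) =
        PlaneEdge.ord (L.graph.edgeImage (placementOfCoords fun k => z (Sum.inl k)) e)
          (L.graph.edgeImage (placementOfCoords fun k => z (Sum.inl k)) e')} := by
    rw [annotatedCoords_image]
    ext z
    constructor
    · rintro ⟨C, hC, h⟩
      obtain rfl : z = annotatedCoords (L.graph.annot C) := by
        rw [h, annotatedCoords_annotatedOfCoords]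
      exact ⟨hC, fun _ _ => rfl⟩
    · rintro ⟨h₁, h₂⟩
      refine ⟨_, h₁, Prod.ext rfl ?_⟩
      ext e e'
      exact (h₂ e e').symm
  rw [this]
  exact (L.isSemialgebraic_nconfRel ε Sum.inl).and (.forall_finite fun e => .forall_finite fun e' =>
    .setOf_eq (.of_coord _) (isSemialgebraicFun_ord _ _ _ _))

theorem isSemialgebraic_noncrossingConfRel [Finite V] [Finite E] (L : Linkage V E) (ε : ℝ) :
    IsSemialgebraic (annotatedCoords '' L.NoncrossingConfRel ε) := by
  -- The approximating annotation is a function of the approximating placement, so only `y` and `δ`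
  -- are quantified. The bound 1 compares with the lengths realized by `z` itself, since these
  -- belong to the linkage whose closure is taken.
  have key : ∀ z : (V × Fin 2) ⊕ (E × E) → ℝ, annotatedOfCoords z ∈ L.NoncrossingConfRel ε ↔
      placementOfCoords (fun k => z (Sum.inl k)) ∈ L.ConfRel ε ∧
      ∀ δ : ℝ, 0 < δ → ∃ y : V × Fin 2 → ℝ,
        ((∀ e, |L.graph.barDist (placementOfCoords fun k => z (Sum.inl k)) e -
            L.graph.barDist (placementOfCoords fun k => y k) e| ≤ 1) ∧
          (placementOfCoords fun k => y k) ∈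
            (L.graph.inducedLinkage (placementOfCoords fun k => y k)).NConf) ∧
        (∀ k, |z (Sum.inl k) - y k| < δ) ∧
        ∀ e e', |z (Sum.inr (e, e')) -
          PlaneEdge.ord (L.graph.edgeImage (placementOfCoords fun k => y k) e)
            (L.graph.edgeImage (placementOfCoords fun k => y k) e')| < δ := by
    intro z
    rw [mem_noncrossingConfRel_iff, mem_confRel_iff, mem_closure_iff_annotatedCoords]
    refine and_congr_right fun _ => forall₂_congr fun δ _ => ?_
    constructor
    · rintro ⟨_, ⟨C, hC, rfl⟩, h⟩
      exact ⟨placementCoords C, mem_nconfRel_iff.1 hC, fun k => h (Sum.inl k),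
        fun e e' => h (Sum.inr (e, e'))⟩
    · rintro ⟨y, hy, h₁, h₂⟩
      refine ⟨_, ⟨placementOfCoords y, mem_nconfRel_iff.2 hy, rfl⟩, ?_⟩
      rintro (k | k)
      · exact h₁ k
      · exact h₂ _ _
  simp only [annotatedCoords_image, key]
  refine .and (L.isSemialgebraic_confRel ε Sum.inl) (.forall_real (.imp
    (.setOf_lt (.const 0) (.of_coord _)) (.exists_pi ?_)))
  refine .and (.and (.forall_finite fun e => ?_) ?_) (.and (.forall_finite fun k => ?_)
    (.forall_finite fun e => .forall_finite fun e' => ?_))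
  · exact .setOf_le (.abs (.sub (.barDist _ isSemialgebraicPlane_placementOfCoords e)
      (.barDist _ isSemialgebraicPlane_placementOfCoords e))) (.const _)
  · exact .inducedLinkage_nconf _ isSemialgebraicPlane_placementOfCoords
  · exact .setOf_lt (.abs (.sub (.of_coord _) (.of_coord _))) (.of_coord _)
  · exact .setOf_lt (.abs (.sub (.of_coord _) (isSemialgebraicFun_ord _ _ _ _))) (.of_coord _)

end Linkage

theorem mainTheorem4 {V E : Type*} [Finite V] [Finite E] (L : Linkage V E) (ε : ℝ) (hε : 0 ≤ ε) :
    IsSemialgebraic (placementCoords '' L.ConfRel ε) ∧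
    IsSemialgebraic (placementCoords '' L.NConfRel ε) ∧
    IsSemialgebraic (annotatedCoords '' L.AnnNConfRel ε) ∧
    IsSemialgebraic (annotatedCoords '' L.NoncrossingConf) ∧
    IsSemialgebraic (annotatedCoords '' L.NoncrossingConfRel ε) := by
  refine ⟨?_, ?_, L.isSemialgebraic_annNConfRel ε, ?_, L.isSemialgebraic_noncrossingConfRel ε⟩
  · rw [placementCoords_image]
    exact L.isSemialgebraic_confRel ε id
  · rw [placementCoords_image]
    exact L.isSemialgebraic_nconfRel ε id
  -- Being 0-related means being equal, so this is the case ε = 0 of the last set.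
  · rw [L.noncrossingConf_eq]
    exact L.isSemialgebraic_noncrossingConfRel 0
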